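/- Let $k$ be a complete valued field with non-trivial valuation, Archimedean or not. Fix a meaning of "Banach space over $k$": either norms satisfy the ordinary triangle inequality, or, if $k$ is non-Archimedean, they are required to satisfy the strong triangle inequality. Let $\mathrm{Ban}_k$ be the category of Banach spaces over $k$ and bounded linear maps, with the completed projective tensor product $\hat\otimes$ (in the strong convention its norm is defined with $\max_i \|x_i\|\|y_i\|$ in place of $\sum_i \|x_i\|\|y_i\|$). Let $\mathrm{IndBan}_k$ be its Ind-completion: objects are small filtered diagrams $X=\text{"colim"}_{i} X_i$ in $\mathrm{Ban}_k$, and $\mathrm{Hom}(X,Y)=\lim_i\operatorname{colim}_j\mathrm{Hom}(X_i,Y_j)$. It is closed monoidal, with $X\hat\otimes Y=\text{"colim"}_{i,j}X_i\hat\otimes Y_j$, unit object $k$ and internal hom $\underline{\mathrm{Hom}}$, and is thereby enriched over itself. For a set $S$ and a Banach space $V$, let $\coprod_S^{\le 1}V$ be the Banach space of families $(v_s)_{s\in S}$ in $V$ with $\sum_s\|v_s\|<\infty$, normed by $\sum_s\|v_s\|$ (in the strong convention: with $\|v_s\|\to 0$, normed by $\sup_s\|v_s\|$). Put $\coprod_S^{\le1}X=\text{"colim"}_i\coprod_S^{\le1}X_i$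 for $X=\text{"colim"}_iX_i$ in $\mathrm{IndBan}_k$, and $l^1(S)=\coprod_S^{\le 1}k$. If $F$ is an $\mathrm{IndBan}_k$-enriched endofunctor of $\mathrm{IndBan}_k$, the natural map $\coprod_S^{\le1}F(k)\to F(l^1(S))$ is the following one: the uniformly bounded family of the inclusions $k\to l^1(S)$ is a morphism $l^1(S)\to\underline{\mathrm{Hom}}(k,l^1(S))$; composing it with $\underline{\mathrm{Hom}}(k,l^1(S))\to\underline{\mathrm{Hom}}(F(k),F(l^1(S)))$ gives by adjunction a morphism $F(k)\hat\otimes l^1(S)\to F(l^1(S))$, and this is composed with the canonical map $\coprod_S^{\le1}F(k)\to F(k)\hat\otimes l^1(S)$. One says that $F$ commutes with $l^1$ if this map is an isomorphism for every set $S$. **Lemma.** Let $\mathscr V:\mathrm{IndBan}_k\to\mathrm{IndBan}_k$ be a functor. Then $\mathscr V$ is naturally isomorphic to $V\hat\otimes-$ for some $V\in\mathrm{IndBan}_k$ if and only if $\mathscr V$ preserves all small colimits and admits an $\mathrm{IndBan}_k$-enrichment with respect to which it commutes with $l^1$. Moreover, if $\mathscr V$ is naturally isomorphic to $V\hat\otimes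 -$, then $V\cong\mathscr V(k)$. -/

import Mathlib

open CategoryTheory MonoidalCategory Limits
open scoped TensorProduct

universe u

noncomputable section

/-- The meaning of "Banach space" over `k`: either norms satisfy the ordinary triangle inequality,
or, if `k` is non-Archimedean, they are required to satisfy the strong one. -/
inductive BanachConvention (k : Type u) [NontriviallyNormedField k] : Type
  | ordinary : BanachConvention k
  | strong (h : IsUltrametricDist k) : BanachConvention k

namespace BanachConvention

variable {k : Type u} [NontriviallyNormedField k]

/-- The strong triangle inequality, imposed only in the second convention. -/
def Admits (c : BanachConvention k) (V : Type u) [NormedAddCommGroup V] : Prop :=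
  match c with
  | ordinary => True
  | strong _ => IsUltrametricDist V

/-- `‖x + y‖ ≤ c.add ‖x‖ ‖y‖`: the sum, or the maximum. -/
def add (c : BanachConvention k) (a b : ℝ) : ℝ :=
  match c with
  | ordinary => a + b
  | strong _ => max a b

variable (c : BanachConvention k)

lemma add_mono {a b a' b' : ℝ} (h : a ≤ a') (h' : b ≤ b') : c.add a b ≤ c.add a' b' := by
  cases c
  · exact add_le_add h h'
  · exact max_le_max h h'

lemma add_le_add' {a b : ℝ} (h : 0 ≤ a) (h' : 0 ≤ b) : c.add a b ≤ a + b := by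
  cases c
  · exact le_rfl
  · exact max_le (by linarith) (by linarith)

lemma add_nonneg' {a b : ℝ} (h : 0 ≤ a) (h' : 0 ≤ b) : 0 ≤ c.add a b := by
  cases c
  · exact add_nonneg h h'
  · exact le_max_of_le_left h

lemma add_assoc' (a b d : ℝ) : c.add (c.add a b) d = c.add a (c.add b d) := by
  cases c
  · exact add_assoc a b d
  · exact max_assoc a b d

lemma zero_add' {a : ℝ} (h : 0 ≤ a) : c.add 0 a = a := by
  cases c
  · exact zero_add a
  · exact max_eq_right h

lemma mul_add' {r : ℝ} (hr : 0 ≤ r) (a b : ℝ) : c.add (r * a) (r * b) = r * c.add a b := by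
  cases c
  · exact (mul_add r a b).symm
  · exact (mul_max_of_nonneg a b hr).symm

lemma add_eps {a b e : ℝ} (he : 0 ≤ e) : c.add (a + e) (b + e) ≤ c.add a b + 2 * e := by
  cases c
  · show a + e + (b + e) ≤ a + b + 2 * e
    linarith
  · show max (a + e) (b + e) ≤ max a b + 2 * e
    exact max_le (by linarith [le_max_left a b]) (by linarith [le_max_right a b])

lemma continuous_add : Continuous fun p : ℝ × ℝ => c.add p.1 p.2 := by
  cases c
  · exact continuous_fst.add continuous_snd
  · exact continuous_fst.max continuous_snd

lemma admits_iff (V : Type u) [NormedAddCommGroup V] :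
    c.Admits V ↔ ∀ x y : V, ‖x + y‖ ≤ c.add ‖x‖ ‖y‖ := by
  cases c
  · exact ⟨fun _ => norm_add_le, fun _ => trivial⟩
  · constructor
    · intro h
      have : IsUltrametricDist V := h
      exact IsUltrametricDist.norm_add_le_max
    · intro h
      exact IsUltrametricDist.isUltrametricDist_of_forall_norm_add_le_max_norm h

lemma admits_self : c.Admits k := by
  cases c with
  | ordinary => trivial
  | strong h => exact h

end BanachConvention

/-- A Banach space over `k`, equipped with a specific norm. -/
structure Ban {k : Type u} [NontriviallyNormedField k] (c : BanachConvention k) :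
    Type (u + 1) where
  carrier : Type u
  [normedAddCommGroup : NormedAddCommGroup carrier]
  [normedSpace : NormedSpace k carrier]
  [completeSpace : CompleteSpace carrier]
  admits : c.Admits carrier

namespace Ban

variable {k : Type u} [NontriviallyNormedField k] {c : BanachConvention k}

instance : CoeSort (Ban c) (Type u) := ⟨Ban.carrier⟩

attribute [instance] Ban.normedAddCommGroup Ban.normedSpace Ban.completeSpace

lemma norm_add (V : Ban c) (x y : V) : ‖x + y‖ ≤ c.add ‖x‖ ‖y‖ :=
  (c.admits_iff V).1 V.admits x y

/-- Morphisms are the bounded linear maps. -/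
instance : Category (Ban c) where
  Hom V W := V →L[k] W
  id V := ContinuousLinearMap.id k V
  comp f g := ContinuousLinearMap.comp g f

/-- A morphism of Banach spaces as a bounded linear map. -/
def Hom.clm {V W : Ban c} (f : V ⟶ W) : V →L[k] W := f

/-- A bounded linear map as a morphism of Banach spaces. -/
def ofClm {V W : Ban c} (f : V →L[k] W) : V ⟶ W := f

@[simp] lemma ofClm_clm {V W : Ban c} (f : V ⟶ W) : ofClm (Hom.clm f) = f := rfl
@[simp] lemma clm_ofClm {V W : Ban c} (f : V →L[k] W) : Hom.clm (ofClm f) = f := rfl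
@[simp] lemma clm_id (V : Ban c) : Hom.clm (𝟙 V) = ContinuousLinearMap.id k V := rfl
@[simp] lemma clm_comp {U V W : Ban c} (f : U ⟶ V) (g : V ⟶ W) :
    Hom.clm (f ≫ g) = (Hom.clm g).comp (Hom.clm f) := rfl

@[ext] lemma hom_ext {V W : Ban c} {f g : V ⟶ W} (h : ∀ x, Hom.clm f x = Hom.clm g x) : f = g :=
  ContinuousLinearMap.ext h

/-! ### The completed projective tensor product -/

section Tensor

variable (V W : Ban c)

/-- The algebraic tensor product, to be given the projective seminorm. -/
def AlgTensor : Type u := V ⊗[k] W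

instance : AddCommGroup (AlgTensor V W) :=
  (TensorProduct.addCommGroup : AddCommGroup (V ⊗[k] W))

instance : Module k (AlgTensor V W) :=
  (TensorProduct.leftModule : Module k (V ⊗[k] W))

variable {V W}

/-- The pure tensor `x ⊗ y`. -/
def algTmul (x : V) (y : W) : AlgTensor V W := (x ⊗ₜ[k] y : V ⊗[k] W)

lemma algTensor_induction {P : AlgTensor V W → Prop} (h0 : P 0) (h1 : ∀ x y, P (algTmul x y))
    (h2 : ∀ s t, P s → P t → P (s + t)) (t : AlgTensor V W) : P t :=
  TensorProduct.induction_on t h0 h1 h2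

/-- `∑ i, xᵢ ⊗ yᵢ`. -/
def tensorSum (l : List (V × W)) : AlgTensor V W :=
  (l.map fun p => algTmul p.1 p.2).sum

lemma tensorSum_cons (p : V × W) (l : List (V × W)) :
    tensorSum (p :: l) = algTmul p.1 p.2 + tensorSum l := by
  simp only [tensorSum, List.map_cons, List.sum_cons]

/-- `∑ i, ‖xᵢ‖ ‖yᵢ‖` for the ordinary convention, `maxᵢ ‖xᵢ‖ ‖yᵢ‖` for the strong one. -/
def tensorCost (l : List (V × W)) : ℝ :=
  l.foldr (fun p r => c.add (‖p.1‖ * ‖p.2‖) r) 0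

lemma tensorCost_nonneg (l : List (V × W)) : 0 ≤ tensorCost l := by
  induction l with
  | nil => exact le_rfl
  | cons p l ih => exact c.add_nonneg' (by positivity) ih

lemma tensorSum_append (l l' : List (V × W)) :
    tensorSum (l ++ l') = tensorSum l + tensorSum l' := by
  simp only [tensorSum, List.map_append, List.sum_append]

lemma tensorCost_append (l l' : List (V × W)) :
    tensorCost (l ++ l') = c.add (tensorCost l) (tensorCost l') := by
  induction l with
  | nil => exact (c.zero_add' (tensorCost_nonneg l')).symm
  | cons p l ih =>
    change c.add _ (tensorCost (l ++ l')) = c.add (c.add _ (tensorCost l)) _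
    rw [ih, c.add_assoc']

lemma tensorSum_smul (a : k) (l : List (V × W)) :
    tensorSum (l.map fun p => (a • p.1, p.2)) = a • tensorSum l := by
  induction l with
  | nil => exact (smul_zero a).symm
  | cons p l ih =>
    rw [List.map_cons, tensorSum_cons, tensorSum_cons, ih, smul_add]
    rfl

lemma tensorCost_smul (a : k) (l : List (V × W)) :
    tensorCost (l.map fun p => (a • p.1, p.2)) = ‖a‖ * tensorCost l := by
  induction l with
  | nil => exact (mul_zero _).symm
  | cons p l ih =>
    change c.add (‖a • p.1‖ * ‖p.2‖) (tensorCost (l.map _)) = ‖a‖ * c.add _ (tensorCost l)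
    rw [ih, norm_smul, mul_assoc, c.mul_add' (norm_nonneg a)]

lemma exists_tensorSum (t : AlgTensor V W) : ∃ l, tensorSum l = t := by
  refine algTensor_induction (P := fun t => ∃ l, tensorSum l = t)
    ⟨[], rfl⟩ (fun x y => ⟨[(x, y)], ?_⟩) ?_ t
  · simp [tensorSum]
  · rintro x y ⟨l, rfl⟩ ⟨l', rfl⟩
    exact ⟨l ++ l', tensorSum_append l l'⟩

/-- The projective tensor seminorm of `t`: the infimum, over all representations
`t = ∑ i, xᵢ ⊗ yᵢ`, of `∑ i, ‖xᵢ‖ ‖yᵢ‖` (respectively of `maxᵢ ‖xᵢ‖ ‖yᵢ‖`). -/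
def projNorm (t : AlgTensor V W) : ℝ := sInf (tensorCost '' {l : List (V × W) | tensorSum l = t})

lemma projNorm_bdd (t : AlgTensor V W) :
    BddBelow (tensorCost '' {l : List (V × W) | tensorSum l = t}) := by
  refine ⟨0, ?_⟩
  rintro _ ⟨l, -, rfl⟩
  exact tensorCost_nonneg l

lemma projNorm_nonneg (t : AlgTensor V W) : 0 ≤ projNorm t := by
  refine Real.sInf_nonneg ?_
  rintro _ ⟨l, -, rfl⟩
  exact tensorCost_nonneg l

lemma projNorm_le (l : List (V × W)) : projNorm (tensorSum l) ≤ tensorCost l :=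
  csInf_le (projNorm_bdd _) ⟨l, rfl, rfl⟩

lemma exists_cost_lt (t : AlgTensor V W) {e : ℝ} (he : 0 < e) :
    ∃ l, tensorSum l = t ∧ tensorCost l < projNorm t + e := by
  obtain ⟨l₀, h₀⟩ := exists_tensorSum t
  obtain ⟨_, ⟨l, hl, rfl⟩, h⟩ := exists_lt_of_csInf_lt
    (s := tensorCost '' {l : List (V × W) | tensorSum l = t}) ⟨_, l₀, h₀, rfl⟩
    (lt_add_of_pos_right (projNorm t) he)
  exact ⟨l, hl, h⟩

lemma projNorm_add (s t : AlgTensor V W) : projNorm (s + t) ≤ c.add (projNorm s) (projNorm t) := by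
  refine le_of_forall_pos_le_add fun e he => ?_
  obtain ⟨l, rfl, hl⟩ := exists_cost_lt s (half_pos he)
  obtain ⟨l', rfl, hl'⟩ := exists_cost_lt t (half_pos he)
  rw [← tensorSum_append]
  calc _ ≤ tensorCost (l ++ l') := projNorm_le _
    _ = c.add (tensorCost l) (tensorCost l') := tensorCost_append l l'
    _ ≤ c.add _ _ := c.add_mono hl.le hl'.le
    _ ≤ _ := c.add_eps (half_pos he).le
    _ = _ := by ring

lemma projNorm_smul (a : k) (t : AlgTensor V W) : projNorm (a • t) ≤ ‖a‖ * projNorm t := by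
  refine le_of_forall_pos_le_add fun e he => ?_
  have hp : 0 < ‖a‖ + 1 := by positivity
  obtain ⟨l, rfl, hl⟩ := exists_cost_lt t (div_pos he hp)
  rw [← tensorSum_smul]
  calc _ ≤ tensorCost (l.map fun p => (a • p.1, p.2)) := projNorm_le _
    _ = ‖a‖ * tensorCost l := tensorCost_smul a l
    _ ≤ ‖a‖ * (projNorm (tensorSum l) + e / (‖a‖ + 1)) := by gcongr
    _ = ‖a‖ * projNorm (tensorSum l) + (‖a‖ / (‖a‖ + 1)) * e := by ring
    _ ≤ _ := by
      have : ‖a‖ / (‖a‖ + 1) ≤ 1 := by rw [div_le_one hp]; linarith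
      nlinarith

variable (V W)

/-- The projective seminorm. -/
def projSeminorm : Seminorm k (AlgTensor V W) :=
  Seminorm.ofSMulLE projNorm
    (le_antisymm (projNorm_le (V := V) (W := W) []) (projNorm_nonneg _))
    (fun s t => (projNorm_add s t).trans
      (c.add_le_add' (projNorm_nonneg s) (projNorm_nonneg t)))
    projNorm_smul

instance : SeminormedAddCommGroup (AlgTensor V W) :=
  (projSeminorm V W).toSeminormedAddCommGroup

instance : NormedSpace k (AlgTensor V W) where
  norm_smul_le a t := projNorm_smul a t

/-- The completed projective tensor product of Banach spaces. -/
def tensor : Ban c where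
  carrier := UniformSpace.Completion (AlgTensor V W)
  admits := by
    rw [c.admits_iff]
    intro x y
    induction x, y using UniformSpace.Completion.induction_on₂ with
    | hp =>
      exact isClosed_le (by fun_prop)
        (c.continuous_add.comp ((continuous_norm.comp continuous_fst).prodMk
          (continuous_norm.comp continuous_snd)))
    | ih s t =>
      rw [← UniformSpace.Completion.coe_add]
      simp only [UniformSpace.Completion.norm_coe]
      exact projNorm_add s t

/-- The pure tensors, as a bounded bilinear map. -/
def tmul : V →L[k] W →L[k] tensor V W :=
  LinearMap.mkContinuous₂
    ((TensorProduct.mk k V W).compr₂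
      ((UniformSpace.Completion.toComplL (𝕜 := k) (E := AlgTensor V W)).toLinearMap)) 1
    (fun x y => by
      change ‖(algTmul x y : UniformSpace.Completion (AlgTensor V W))‖ ≤ _
      rw [one_mul]
      refine (UniformSpace.Completion.norm_coe _).trans_le ?_
      have h := projNorm_le (V := V) (W := W) [(x, y)]
      have h' : tensorCost [(x, y)] ≤ ‖x‖ * ‖y‖ :=
        (c.add_le_add' (by positivity) le_rfl).trans (by simp)
      have h'' : tensorSum [(x, y)] = algTmul x y := by simp [tensorSum]
      rw [h''] at h
      exact h.trans h')

lemma norm_tmul_le (x : V) (y : W) : ‖tmul V W x y‖ ≤ ‖x‖ * ‖y‖ := by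
  refine ((tmul V W).le_opNorm₂ x y).trans ?_
  have : ‖tmul V W‖ ≤ 1 := LinearMap.mkContinuous₂_norm_le _ zero_le_one _
  calc ‖tmul V W‖ * ‖x‖ * ‖y‖ ≤ 1 * ‖x‖ * ‖y‖ := by gcongr
    _ = _ := by ring

variable {V W}

lemma tensor_denseRange :
    Dense (Submodule.span k {t : tensor V W | ∃ x y, t = tmul V W x y} : Set (tensor V W)) := by
  refine (UniformSpace.Completion.denseRange_coe (α := AlgTensor V W)).mono ?_
  rintro _ ⟨t, rfl⟩
  refine algTensor_induction (P := fun t =>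
    ((t : UniformSpace.Completion (AlgTensor V W)) : tensor V W) ∈
      Submodule.span k {t : tensor V W | ∃ x y, t = tmul V W x y})
    ?_ (fun x y => Submodule.subset_span ⟨x, y, rfl⟩) ?_ t
  · exact Submodule.zero_mem _
  · intro s t hs ht
    rw [UniformSpace.Completion.coe_add]
    exact Submodule.add_mem _ hs ht

lemma tensor_clm_ext {Z : Type*} [NormedAddCommGroup Z] [NormedSpace k Z]
    {f g : tensor V W →L[k] Z} (h : ∀ x y, f (tmul V W x y) = g (tmul V W x y)) : f = g := by
  refine ContinuousLinearMap.ext_on (s := {t : tensor V W | ∃ x y, t = tmul V W x y})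
    tensor_denseRange ?_
  rintro _ ⟨x, y, rfl⟩
  exact h x y

variable {Z : Ban c}

lemma norm_lift_le (B : V →L[k] W →L[k] Z) (t : AlgTensor V W) :
    ‖TensorProduct.lift ((ContinuousLinearMap.coeLM k).comp B.toLinearMap) t‖ ≤ ‖B‖ * ‖t‖ := by
  have key : ∀ l : List (V × W),
      ‖TensorProduct.lift ((ContinuousLinearMap.coeLM k).comp B.toLinearMap) (tensorSum l)‖
        ≤ ‖B‖ * tensorCost l := by
    intro l
    induction l with
    | nil =>
      refine (congrArg norm (map_zero _)).trans_le ?_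
      simp [tensorCost]
    | cons p l ih =>
      rw [tensorSum_cons]
      refine (congrArg norm (map_add (TensorProduct.lift
        ((ContinuousLinearMap.coeLM k).comp B.toLinearMap)) _ _)).trans_le ?_
      refine (Z.norm_add _ _).trans ?_
      refine (c.add_mono (a' := ‖B‖ * (‖p.1‖ * ‖p.2‖)) ?_ ih).trans
        (c.mul_add' (norm_nonneg B) _ _).le
      rw [← mul_assoc]
      exact B.le_opNorm₂ p.1 p.2
  refine le_of_forall_pos_le_add fun e he => ?_
  have hp : 0 < ‖B‖ + 1 := by positivity
  obtain ⟨l, rfl, hl⟩ := exists_cost_lt t (div_pos he hp)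
  refine (key l).trans ?_
  calc ‖B‖ * tensorCost l ≤ ‖B‖ * (projNorm (tensorSum l) + e / (‖B‖ + 1)) := by gcongr
    _ = ‖B‖ * projNorm (tensorSum l) + (‖B‖ / (‖B‖ + 1)) * e := by ring
    _ ≤ ‖B‖ * projNorm (tensorSum l) + e := by
      have : ‖B‖ / (‖B‖ + 1) ≤ 1 := by rw [div_le_one hp]; linarith
      nlinarith

/-- The universal property of the completed tensor product. -/
def tensorLift (B : V →L[k] W →L[k] Z) : tensor V W →L[k] Z :=
  ContinuousLinearMap.extend
    (LinearMap.mkContinuous (E := AlgTensor V W)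
      (TensorProduct.lift ((ContinuousLinearMap.coeLM k).comp B.toLinearMap)) ‖B‖
      (norm_lift_le B))
    (UniformSpace.Completion.toComplL (𝕜 := k) (E := AlgTensor V W))

@[simp] lemma tensorLift_tmul (B : V →L[k] W →L[k] Z) (x : V) (y : W) :
    tensorLift B (tmul V W x y) = B x y := by
  refine (ContinuousLinearMap.extend_eq _ UniformSpace.Completion.denseRange_coe
    (UniformSpace.Completion.isUniformInducing_coe (AlgTensor V W)) (algTmul x y)).trans ?_
  exact TensorProduct.lift.tmul x y

end Tensor

lemma tensor_hom_ext {V W Z : Ban c} {f g : tensor V W ⟶ Z}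
    (h : ∀ x y, Hom.clm f (tmul V W x y) = Hom.clm g (tmul V W x y)) : f = g :=
  tensor_clm_ext (f := Hom.clm f) (g := Hom.clm g) h

/-- The Banach space of bounded linear maps with the operator norm. -/
def hom (V W : Ban c) : Ban c where
  carrier := V →L[k] W
  admits := by
    rw [c.admits_iff]
    intro f g
    refine ContinuousLinearMap.opNorm_le_bound _
      (c.add_nonneg' (norm_nonneg f) (norm_nonneg g)) fun x => ?_
    refine (W.norm_add (f x) (g x)).trans ?_
    refine (c.add_mono (f.le_opNorm x) (g.le_opNorm x)).trans ?_
    rw [mul_comm ‖f‖, mul_comm ‖g‖, c.mul_add' (norm_nonneg x), mul_comm]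

/-- The tensor product of two bounded linear maps. -/
def tensorMap {V V' W W' : Ban c} (f : V ⟶ V') (g : W ⟶ W') : tensor V W ⟶ tensor V' W' :=
  ofClm (tensorLift ((tmul V' W').bilinearComp (Hom.clm f) (Hom.clm g)))

@[simp] lemma tensorMap_tmul {V V' W W' : Ban c} (f : V ⟶ V') (g : W ⟶ W') (x : V) (y : W) :
    Hom.clm (tensorMap f g) (tmul V W x y) = tmul V' W' (Hom.clm f x) (Hom.clm g y) :=
  tensorLift_tmul _ x y

/-- `(x ⊗ y) ⊗ z ↦ x ⊗ (y ⊗ z)`. -/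
def assocHom (U V W : Ban c) : tensor (tensor U V) W ⟶ tensor U (tensor V W) :=
  ofClm (tensorLift (tensorLift (Z := hom W (tensor U (tensor V W)))
    ((ContinuousLinearMap.compL k W (tensor V W) (tensor U (tensor V W))).bilinearComp
      (tmul U (tensor V W)) (tmul V W))))

@[simp] lemma assocHom_tmul (U V W : Ban c) (x : U) (y : V) (z : W) :
    Hom.clm (assocHom U V W) (tmul _ W (tmul U V x y) z) = tmul U _ x (tmul V W y z) := by
  refine (tensorLift_tmul _ (tmul U V x y) z).trans ?_
  exact congrArg (fun f : W →L[k] tensor U (tensor V W) => f z)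
    (tensorLift_tmul (Z := hom W (tensor U (tensor V W))) _ x y)

/-- `x ⊗ (y ⊗ z) ↦ (x ⊗ y) ⊗ z`. -/
def assocInv (U V W : Ban c) : tensor U (tensor V W) ⟶ tensor (tensor U V) W :=
  ofClm (tensorLift (ContinuousLinearMap.flip
    (tensorLift (Z := hom U (tensor (tensor U V) W))
      (((ContinuousLinearMap.compL k U (tensor U V) (tensor (tensor U V) W)).bilinearComp
        (tmul (tensor U V) W).flip (tmul U V).flip).flip))))

@[simp] lemma assocInv_tmul (U V W : Ban c) (x : U) (y : V) (z : W) :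
    Hom.clm (assocInv U V W) (tmul U _ x (tmul V W y z)) = tmul _ W (tmul U V x y) z := by
  refine (tensorLift_tmul _ x (tmul V W y z)).trans ?_
  exact congrArg (fun f : U →L[k] tensor (tensor U V) W => f x)
    (tensorLift_tmul (Z := hom U (tensor (tensor U V) W)) _ y z)

lemma tensor_hom_ext₃ {U V W Z : Ban c} {f g : tensor (tensor U V) W ⟶ Z}
    (h : ∀ x y z, Hom.clm f (tmul _ W (tmul U V x y) z) = Hom.clm g (tmul _ W (tmul U V x y) z)) :
    f = g := by
  refine tensor_hom_ext fun t z => ?_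
  refine congrArg (fun F : tensor U V →L[k] Z => F t) (tensor_clm_ext
    (f := (Hom.clm f).comp ((tmul _ W).flip z)) (g := (Hom.clm g).comp ((tmul _ W).flip z)) ?_)
  exact fun x y => h x y z

lemma tensor_hom_ext₃' {U V W Z : Ban c} {f g : tensor U (tensor V W) ⟶ Z}
    (h : ∀ x y z, Hom.clm f (tmul U _ x (tmul V W y z)) = Hom.clm g (tmul U _ x (tmul V W y z))) :
    f = g := by
  refine tensor_hom_ext fun x t => ?_
  refine congrArg (fun F : tensor V W →L[k] Z => F t) (tensor_clm_ext
    (f := (Hom.clm f).comp (tmul U _ x)) (g := (Hom.clm g).comp (tmul U _ x)) ?_)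
  exact fun y z => h x y z

lemma tensor_hom_ext₄ {T U V W Z : Ban c} {f g : tensor (tensor (tensor T U) V) W ⟶ Z}
    (h : ∀ t x y z, Hom.clm f (tmul _ W (tmul _ V (tmul T U t x) y) z) =
      Hom.clm g (tmul _ W (tmul _ V (tmul T U t x) y) z)) :
    f = g := by
  refine tensor_hom_ext fun s z => ?_
  refine congrArg (fun F : tensor (tensor T U) V ⟶ Z => Hom.clm F s) (tensor_hom_ext₃
    (f := ofClm ((Hom.clm f).comp ((tmul _ W).flip z)))
    (g := ofClm ((Hom.clm g).comp ((tmul _ W).flip z))) ?_)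
  exact fun t x y => h t x y z

lemma tmul_smul_left {V W : Ban c} (a : k) (x : V) (y : W) :
    tmul V W (a • x) y = tmul V W x (a • y) := by
  rw [map_smul, map_smul, smul_apply]

variable [CompleteSpace k]

/-- The base field as a Banach space over itself. -/
def unit (c : BanachConvention k) : Ban c where
  carrier := k
  admits := c.admits_self

/-- `1 ∈ k`. -/
def one : unit c := (1 : k)

/-- An element of the unit object, as a scalar. -/
def scalar (a : unit c) : k := a

/-- `a ⊗ x ↦ a x`. -/
def leftUnitorHom (V : Ban c) : tensor (unit c) V ⟶ V :=
  ofClm (tensorLift (V := unit c) (ContinuousLinearMap.lsmul k k))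

@[simp] lemma leftUnitorHom_tmul (V : Ban c) (a : unit c) (x : V) :
    Hom.clm (leftUnitorHom V) (tmul (unit c) V a x) = scalar a • x :=
  tensorLift_tmul (V := unit c) _ a x

/-- `x ⊗ a ↦ a x`. -/
def rightUnitorHom (V : Ban c) : tensor V (unit c) ⟶ V :=
  ofClm (tensorLift (W := unit c) (ContinuousLinearMap.lsmul k k).flip)

@[simp] lemma rightUnitorHom_tmul (V : Ban c) (x : V) (a : unit c) :
    Hom.clm (rightUnitorHom V) (tmul V (unit c) x a) = scalar a • x :=
  tensorLift_tmul (W := unit c) _ x a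

lemma unit_eq_smul_one (a : unit c) : a = scalar a • (one : unit c) :=
  (mul_one (scalar a)).symm

@[simp] lemma one_smul' {V : Ban c} (x : V) : scalar (one : unit c) • x = x :=
  one_smul k x

lemma leftUnitor_hom_inv (V : Ban c) :
    leftUnitorHom V ≫ ofClm (tmul (unit c) V one) = 𝟙 _ := tensor_hom_ext fun a x => by
  rw [clm_comp, ContinuousLinearMap.comp_apply, leftUnitorHom_tmul, clm_ofClm, ← tmul_smul_left,
    ← unit_eq_smul_one]
  rfl

lemma rightUnitor_hom_inv (V : Ban c) :
    rightUnitorHom V ≫ ofClm ((tmul V (unit c)).flip one) = 𝟙 _ := tensor_hom_ext fun x a => by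
  rw [clm_comp, ContinuousLinearMap.comp_apply, rightUnitorHom_tmul, clm_ofClm,
    ContinuousLinearMap.flip_apply, tmul_smul_left, ← unit_eq_smul_one]
  rfl

lemma leftUnitor_nat {V W : Ban c} (f : V ⟶ W) :
    tensorMap (𝟙 (unit c)) f ≫ leftUnitorHom W = leftUnitorHom V ≫ f :=
  tensor_hom_ext fun a x => by simp

lemma rightUnitor_nat {V W : Ban c} (f : V ⟶ W) :
    tensorMap f (𝟙 (unit c)) ≫ rightUnitorHom W = rightUnitorHom V ≫ f :=
  tensor_hom_ext fun x a => by simp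

lemma triangle' (V W : Ban c) :
    assocHom V (unit c) W ≫ tensorMap (𝟙 V) (leftUnitorHom W) =
      tensorMap (rightUnitorHom V) (𝟙 W) :=
  tensor_hom_ext₃ fun x a y => by simp

/-- The monoidal structure is given by the completed tensor product. -/
instance : MonoidalCategoryStruct (Ban c) where
  tensorObj := tensor
  whiskerLeft V _ _ g := tensorMap (𝟙 V) g
  whiskerRight f W := tensorMap f (𝟙 W)
  tensorHom := tensorMap
  tensorUnit := unit c
  associator U V W :=
    { hom := assocHom U V W
      inv := assocInv U V W
      hom_inv_id := tensor_hom_ext₃ fun x y z => by simp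
      inv_hom_id := tensor_hom_ext₃' fun x y z => by simp }
  leftUnitor V :=
    { hom := leftUnitorHom V
      inv := ofClm (tmul (unit c) V one)
      hom_inv_id := leftUnitor_hom_inv V
      inv_hom_id := by ext x; simp }
  rightUnitor V :=
    { hom := rightUnitorHom V
      inv := ofClm ((tmul V (unit c)).flip one)
      hom_inv_id := rightUnitor_hom_inv V
      inv_hom_id := by ext x; simp }

instance : MonoidalCategory (Ban c) :=
  MonoidalCategory.ofTensorHom
    (id_tensorHom_id := fun V W => tensor_hom_ext fun x y => tensorMap_tmul _ _ x y)
    (id_tensorHom := fun _ _ _ _ => rfl)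
    (tensorHom_id := fun _ _ => rfl)
    (tensorHom_comp_tensorHom := fun f₁ f₂ g₁ g₂ => tensor_hom_ext fun x y => by
      change Hom.clm (tensorMap f₁ f₂ ≫ tensorMap g₁ g₂) _ =
        Hom.clm (tensorMap (f₁ ≫ g₁) (f₂ ≫ g₂)) _
      simp)
    (associator_naturality := fun f₁ f₂ f₃ => tensor_hom_ext₃ fun x y z => by
      change Hom.clm (tensorMap (tensorMap f₁ f₂) f₃ ≫ assocHom _ _ _) _ =
        Hom.clm (assocHom _ _ _ ≫ tensorMap f₁ (tensorMap f₂ f₃)) _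
      simp)
    (leftUnitor_naturality := fun f => leftUnitor_nat f)
    (rightUnitor_naturality := fun f => rightUnitor_nat f)
    (pentagon := fun T U V W => tensor_hom_ext₄ fun t x y z => by
      change Hom.clm (tensorMap (assocHom T U V) (𝟙 W) ≫ assocHom T (tensor U V) W ≫
        tensorMap (𝟙 T) (assocHom U V W)) _ =
        Hom.clm (assocHom (tensor T U) V W ≫ assocHom T U (tensor V W)) _
      simp)
    (triangle := triangle')

/-- Bounded linear maps `V ⊗ W ⟶ Z` from bounded linear maps `W ⟶ Hom(V, Z)`. -/
def uncurry {V W Z : Ban c} (f : W ⟶ hom V Z) : V ⊗ W ⟶ Z :=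
  ofClm (tensorLift (show W →L[k] V →L[k] Z from Hom.clm f).flip)

/-- Bounded linear maps `W ⟶ Hom(V, Z)` from bounded linear maps `V ⊗ W ⟶ Z`. -/
def curry {V W Z : Ban c} (f : V ⊗ W ⟶ Z) : W ⟶ hom V Z :=
  ofClm (V := W) (W := hom V Z) (((ContinuousLinearMap.compL k W (tensor V W) Z).bilinearComp
    (ContinuousLinearMap.id k (tensor V W →L[k] Z)) (tmul V W) (Hom.clm f)).flip)

lemma curry_apply {V W Z : Ban c} (f : V ⊗ W ⟶ Z) (y : W) (x : V) :
    (show V →L[k] Z from Hom.clm (curry f) y) x = Hom.clm f (tmul V W x y) := rfl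

lemma uncurry_tmul {V W Z : Ban c} (f : W ⟶ hom V Z) (x : V) (y : W) :
    Hom.clm (uncurry f) (tmul V W x y) = (show V →L[k] Z from Hom.clm f y) x :=
  tensorLift_tmul _ x y

@[simp] lemma uncurry_curry {V W Z : Ban c} (f : V ⊗ W ⟶ Z) : uncurry (curry f) = f :=
  tensor_hom_ext fun x y => uncurry_tmul _ x y

lemma whiskerLeft_tmul {V W W' : Ban c} (g : W ⟶ W') (x : V) (y : W) :
    Hom.clm (V ◁ g) (tmul V W x y) = tmul V W' x (Hom.clm g y) :=
  tensorMap_tmul _ _ x y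

lemma whiskerRight_tmul {V V' W : Ban c} (g : V ⟶ V') (x : V) (y : W) :
    Hom.clm (g ▷ W) (tmul V W x y) = tmul V' W (Hom.clm g x) y :=
  tensorMap_tmul _ _ x y

end Ban

namespace Ban

variable {k : Type u} [NontriviallyNormedField k] {c : BanachConvention k}

/-! ### Contracting coproducts -/

section Coproduct

open Filter Topology ENNReal

variable {S : Type u}

/-- Families `v` with `∑ s, ‖v s‖ < ∞`, with the norm `∑ s, ‖v s‖`. -/
def l1Coprod (V : S → Ban (.ordinary : BanachConvention k)) :
    Ban (.ordinary : BanachConvention k) where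
  carrier := lp (fun s => (V s : Type u)) 1
  admits := trivial

/-- The families in `ℓ^∞` that tend to zero along the cofinite filter. -/
def c0Submodule {h : IsUltrametricDist k} (V : S → Ban (.strong h)) :
    Submodule k (lp (fun s => (V s : Type u)) ∞) where
  carrier := {v | Tendsto (fun s => ‖v s‖) cofinite (𝓝 0)}
  zero_mem' := by
    change Tendsto (fun s => ‖(0 : V s)‖) cofinite (𝓝 0)
    simpa using tendsto_const_nhds
  add_mem' {v w} hv hw := by
    refine squeeze_zero (fun s => norm_nonneg _) (fun s => norm_add_le (v s) (w s)) ?_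
    simpa using Tendsto.add hv hw
  smul_mem' a v hv := by
    have : Tendsto (fun s => ‖a‖ * ‖v s‖) cofinite (𝓝 (‖a‖ * 0)) := Tendsto.const_mul _ hv
    simpa [norm_smul] using this

lemma isClosed_c0Submodule {h : IsUltrametricDist k} (V : S → Ban (.strong h)) :
    IsClosed (c0Submodule V : Set (lp (fun s => (V s : Type u)) ∞)) := by
  refine isClosed_of_closure_subset fun v hv => ?_
  change Tendsto (fun s => ‖v s‖) cofinite (𝓝 0)
  rw [Metric.tendsto_nhds]
  intro e he
  obtain ⟨w, hw, hvw⟩ := Metric.mem_closure_iff.1 hv (e / 2) (half_pos he)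
  filter_upwards [(Metric.tendsto_nhds.1 hw) (e / 2) (half_pos he)] with s hs
  simp only [dist_zero_right, norm_norm] at hs ⊢
  have h1 : ‖(v - w) s‖ ≤ ‖v - w‖ := lp.norm_apply_le_norm ENNReal.top_ne_zero _ s
  have h2 : v s = (v - w) s + w s := by simp
  rw [dist_eq_norm] at hvw
  calc ‖v s‖ ≤ ‖(v - w) s‖ + ‖w s‖ := by rw [h2]; exact norm_add_le _ _
    _ < e := by linarith

/-- Families `v` with `‖v s‖ → 0`, with the norm `sup_s ‖v s‖`. -/
def c0Coprod {h : IsUltrametricDist k} (V : S → Ban (.strong h)) : Ban (.strong h) where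
  carrier := c0Submodule V
  completeSpace := (isClosed_c0Submodule V).completeSpace_coe
  admits := by
    rw [BanachConvention.admits_iff]
    intro v w
    refine lp.norm_le_of_forall_le (le_max_of_le_left (norm_nonneg v)) fun s => ?_
    refine ((V s).norm_add (v.1 s) (w.1 s)).trans ?_
    exact max_le_max (lp.norm_apply_le_norm ENNReal.top_ne_zero v.1 s)
      (lp.norm_apply_le_norm ENNReal.top_ne_zero w.1 s)

/-- The contracting coproduct of a family of Banach spaces. -/
def coprod : {c : BanachConvention k} → (V : S → Ban c) → Ban c
  | .ordinary, V => l1Coprod V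
  | .strong _, V => c0Coprod V

/-- The inclusion of a summand into the contracting coproduct. -/
def coprodSingle [DecidableEq S] : {c : BanachConvention k} → (V : S → Ban c) → (s : S) →
    (V s →L[k] coprod V)
  | .ordinary, V, s => lp.singleContinuousLinearMap k (fun s => (V s : Type u)) 1 s
  | .strong _, V, s =>
    ContinuousLinearMap.codRestrict
      (lp.singleContinuousLinearMap k (fun s => (V s : Type u)) ∞ s) (c0Submodule V) fun x => by
        change Tendsto _ _ _
        refine tendsto_const_nhds.congr' ?_
        filter_upwards [(Set.finite_singleton s).compl_mem_cofinite] with t ht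
        have ht' : t ≠ s := ht
        simp [ht']

lemma norm_coprodSingle_le [DecidableEq S] (V : S → Ban c) (s : S) (x : V s) :
    ‖coprodSingle V s x‖ ≤ ‖x‖ := by
  cases c with
  | ordinary => exact (lp.norm_single (E := fun s => (V s : Type u)) (p := 1) zero_lt_one s x).le
  | strong h => exact (lp.norm_single (E := fun s => (V s : Type u)) (p := ∞) ENNReal.zero_lt_top s x).le

lemma summable_l1 {V : S → Ban (.ordinary : BanachConvention k)}
    {W : Ban (.ordinary : BanachConvention k)} (g : ∀ s, V s →L[k] W) {M : ℝ}
    (hg : ∀ s, ‖g s‖ ≤ M) (v : l1Coprod V) :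
    Summable (fun s => ‖v.1 s‖) ∧ Summable (fun s => g s (v.1 s)) := by
  have h1 : Summable (fun s => ‖v.1 s‖) := by
    simpa using v.2.summable (by simp)
  refine ⟨h1, Summable.of_norm_bounded (h1.mul_left M) fun s => ?_⟩
  exact (g s).le_of_opNorm_le (hg s) _

lemma summable_c0 {h : IsUltrametricDist k} {V : S → Ban (.strong h)}
    {W : Ban (.strong h)} (g : ∀ s, V s →L[k] W) {M : ℝ}
    (hg : ∀ s, ‖g s‖ ≤ M) (v : c0Coprod V) :
    Summable (fun s => g s (v.1.1 s)) := by
  have : IsUltrametricDist W := W.admits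
  refine NonarchimedeanAddGroup.summable_of_tendsto_cofinite_zero ?_
  rw [tendsto_zero_iff_norm_tendsto_zero]
  refine squeeze_zero (fun s => norm_nonneg _) (fun s => (g s).le_of_opNorm_le (hg s) _) ?_
  simpa using Tendsto.const_mul M v.2

/-- The universal property of the contracting coproduct: a family of linear maps `g s`, all of
norm at most `M`, induces the linear map `v ↦ ∑ s, g s (v s)`. -/
def coprodDesc : {c : BanachConvention k} → {V : S → Ban c} → {W : Ban c} →
    (g : ∀ s, V s →L[k] W) → (M : ℝ) → (∀ s, ‖g s‖ ≤ M) → (coprod V →L[k] W)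
  | .ordinary, V, W, g, M, hg =>
    LinearMap.mkContinuous (E := l1Coprod V)
      { toFun := fun v => ∑' s, g s (v.1 s)
        map_add' := fun v w => by
          rw [← (summable_l1 g hg v).2.tsum_add (summable_l1 g hg w).2]
          exact tsum_congr fun s => map_add (g s) _ _
        map_smul' := fun a v => by
          rw [RingHom.id_apply, ← tsum_const_smul'']
          exact tsum_congr fun s => map_smul (g s) _ _ } M fun v => by
        have h2 : ‖v‖ = ∑' s, ‖v.1 s‖ := by
          refine (lp.norm_eq_tsum_rpow (by simp) v).trans ?_
          simp
        rw [h2, ← tsum_mul_left]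
        exact tsum_of_norm_bounded ((summable_l1 g hg v).1.mul_left M).hasSum
          fun s => (g s).le_of_opNorm_le (hg s) _
  | .strong _, V, W, g, M, hg =>
    LinearMap.mkContinuous (E := c0Coprod V)
      { toFun := fun v => ∑' s, g s (v.1.1 s)
        map_add' := fun v w => by
          rw [← (summable_c0 g hg v).tsum_add (summable_c0 g hg w)]
          exact tsum_congr fun s => map_add (g s) _ _
        map_smul' := fun a v => by
          rw [RingHom.id_apply, ← tsum_const_smul'']
          exact tsum_congr fun s => map_smul (g s) _ _ } (max M 0) fun v => by
        have : IsUltrametricDist W := W.admits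
        refine IsUltrametricDist.norm_tsum_le_of_forall_le_of_nonneg (by positivity) fun s => ?_
        refine (g s).le_of_opNorm_le_of_le ((hg s).trans (le_max_left _ _)) ?_
        exact lp.norm_apply_le_norm ENNReal.top_ne_zero v.1 s

@[simp] lemma coprodDesc_single [DecidableEq S] {V : S → Ban c} {W : Ban c}
    (g : ∀ s, V s →L[k] W) (M : ℝ) (hg : ∀ s, ‖g s‖ ≤ M) (s : S) (x : V s) :
    coprodDesc g M hg (coprodSingle V s x) = g s x := by
  cases c with
  | ordinary =>
    change ∑' t, g t ((lp.single (E := fun s => (V s : Type u)) 1 s x) t) = _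
    rw [tsum_eq_single s fun t ht => by rw [lp.single_apply_ne _ _ _ ht, map_zero],
      lp.single_apply_self]
  | strong h =>
    change ∑' t, g t ((lp.single (E := fun s => (V s : Type u)) ∞ s x) t) = _
    rw [tsum_eq_single s fun t ht => by rw [lp.single_apply_ne _ _ _ ht, map_zero],
      lp.single_apply_self]

lemma coprod_ext [DecidableEq S] {V : S → Ban c} {W : Ban c} {f g : coprod V →L[k] W}
    (h : ∀ s x, f (coprodSingle V s x) = g (coprodSingle V s x)) : f = g := by
  cases c with
  | ordinary =>
    refine ContinuousLinearMap.ext fun v => ?_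
    have hv : HasSum (fun s => coprodSingle V s (v.1 s)) v :=
      lp.hasSum_single (by simp) v
    have h1 := hv.mapL f
    have h2 := hv.mapL g
    simp only [h] at h1
    exact h1.unique h2
  | strong _ =>
    refine ContinuousLinearMap.ext fun v => ?_
    have hv : HasSum (fun s => coprodSingle V s (v.1.1 s)) v := by
      have hs : Summable (fun s => coprodSingle V s (v.1.1 s)) :=
        summable_c0 (W := coprod V) (fun s => coprodSingle V s) (M := 1)
          (fun s => ContinuousLinearMap.opNorm_le_bound _ zero_le_one fun x => by
            rw [one_mul]; exact norm_coprodSingle_le V s x) v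
      convert hs.hasSum
      refine Subtype.ext (lp.ext (funext fun t => ?_))
      let ev : coprod V →L[k] V t :=
        (lp.evalCLM k (fun s => (V s : Type u)) ∞ t).comp (c0Submodule V).subtypeL
      have h3 := (hs.hasSum.mapL ev).tsum_eq
      change _ = ev (∑' s, coprodSingle V s (v.1.1 s))
      rw [← h3, tsum_eq_single t]
      · exact (lp.single_apply_self (E := fun s => (V s : Type u)) ∞ t _).symm
      · intro s hst
        exact lp.single_apply_ne (E := fun s => (V s : Type u)) ∞ s _ hst.symm
    have h1 := hv.mapL f
    have h2 := hv.mapL g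
    simp only [h] at h1
    exact h1.unique h2

open Classical in
/-- The contracting coproduct of copies of one space indexed by `S`, as a functor. -/
def coprodFunctor (S : Type u) : Ban c ⥤ Ban c where
  obj V := coprod fun _ : S => V
  map {V W} f := ofClm (coprodDesc (V := fun _ : S => V)
    (fun s => (coprodSingle (fun _ : S => W) s).comp (Hom.clm f)) ‖Hom.clm f‖ fun s =>
      ContinuousLinearMap.opNorm_le_bound _ (norm_nonneg _) fun x =>
        (norm_coprodSingle_le _ s _).trans ((Hom.clm f).le_opNorm x))
  map_id V := coprod_ext fun s x =>
    coprodDesc_single (V := fun _ : S => V) (W := coprod fun _ : S => V) _ _ _ s x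
  map_comp {U V W} f g := coprod_ext fun s x => by
    change Hom.clm (ofClm _) _ = Hom.clm (ofClm _ ≫ ofClm _) _
    simp

variable [CompleteSpace k]

/-- The space `l¹(S)`: the contracting coproduct of copies of the base field. -/
def l1 (S : Type u) (c : BanachConvention k) : Ban c := (coprodFunctor S).obj (unit c)

open Classical in
/-- The basis vector of `l¹(S)` attached to `s`. -/
def l1Basis (s : S) : l1 S c := coprodSingle (fun _ : S => unit c) s one

/-- The map `∐_S V ⟶ V ⊗ l¹(S)`, `(v s)_s ↦ ∑ s, v s ⊗ δ_s`, natural in `V`. -/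
def coprodToTensor (S : Type u) : coprodFunctor S ⟶ tensorRight (l1 S c) where
  app V := ofClm (coprodDesc (V := fun _ : S => V) (W := tensor V (l1 S c))
    (fun s => (tmul V (l1 S c)).flip (l1Basis s)) 1 fun s =>
      ContinuousLinearMap.opNorm_le_bound _ zero_le_one fun x => by
        have h1 : ‖(l1Basis s : l1 S c)‖ ≤ 1 :=
          by
          classical
          exact (norm_coprodSingle_le (fun _ : S => unit c) s one).trans (norm_one (α := k)).le
        calc _ ≤ ‖x‖ * ‖(l1Basis s : l1 S c)‖ := norm_tmul_le _ _ x (l1Basis s)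
          _ ≤ ‖x‖ * 1 := by gcongr
          _ = _ := mul_comm _ _)
  naturality V W f := by
    classical
    refine coprod_ext fun s x => ?_
    change Hom.clm (ofClm (coprodDesc _ _ _) ≫ ofClm (coprodDesc _ _ _)) _ =
      Hom.clm (ofClm (coprodDesc _ _ _) ≫ f ▷ l1 S c) _
    simp only [clm_comp, ContinuousLinearMap.comp_apply, clm_ofClm, coprodDesc_single,
      ContinuousLinearMap.flip_apply, whiskerRight_tmul]

end Coproduct

end Ban

/-! ### Ind-completions -/

/-- An ind-object `"colim" X i` of `C`: a small filtered diagram in `C`. -/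
structure IndObj (C : Type (u + 1)) [Category.{u} C] : Type (u + 1) where
  I : Type u
  [category : SmallCategory I]
  [isFiltered : IsFiltered I]
  F : I ⥤ C

namespace IndObj

attribute [instance] IndObj.category IndObj.isFiltered

variable {C : Type (u + 1)} [Category.{u} C]

/-- Two morphisms `A ⟶ Y j`, `A ⟶ Y j'` are identified if they agree in some `Y l`. -/
def germSetoid (A : C) (Y : IndObj C) : Setoid (Σ j : Y.I, (A ⟶ Y.F.obj j)) where
  r p q := ∃ (l : Y.I) (u : p.1 ⟶ l) (v : q.1 ⟶ l), p.2 ≫ Y.F.map u = q.2 ≫ Y.F.map v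
  iseqv :=
    { refl := fun p => ⟨p.1, 𝟙 _, 𝟙 _, rfl⟩
      symm := fun ⟨l, u, v, h⟩ => ⟨l, v, u, h.symm⟩
      trans := by
        rintro p q r ⟨l, u, v, h⟩ ⟨l', u', v', h'⟩
        obtain ⟨m, a, b, hab⟩ := IsFiltered.span v u'
        refine ⟨m, u ≫ a, v' ≫ b, ?_⟩
        rw [Functor.map_comp, reassoc_of% h, ← Functor.map_comp, hab, Functor.map_comp,
          reassoc_of% h', Functor.map_comp] }

/-- The filtered colimit `colim_j Hom(A, Y j)`. -/
def Germ (A : C) (Y : IndObj C) : Type u := Quotient (germSetoid A Y)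

namespace Germ

variable {A B : C} {X Y Z : IndObj C}

/-- The class of a morphism `A ⟶ Y j`. -/
def mk (j : Y.I) (f : A ⟶ Y.F.obj j) : Germ A Y := Quotient.mk (germSetoid A Y) ⟨j, f⟩

lemma exists_rep (g : Germ A Y) : ∃ j f, g = mk j f := by
  obtain ⟨⟨j, f⟩, h⟩ := Quotient.exists_rep g
  exact ⟨j, f, h.symm⟩

lemma mk_eq_mk {j j' : Y.I} {f : A ⟶ Y.F.obj j} {f' : A ⟶ Y.F.obj j'} :
    mk j f = mk j' f' ↔ ∃ (l : Y.I) (u : j ⟶ l) (v : j' ⟶ l), f ≫ Y.F.map u = f' ≫ Y.F.map v :=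
  Quotient.eq (r := germSetoid A Y)

lemma mk_map {j l : Y.I} (f : A ⟶ Y.F.obj j) (u : j ⟶ l) : mk l (f ≫ Y.F.map u) = mk j f :=
  mk_eq_mk.2 ⟨l, 𝟙 l, u, by simp⟩

/-- Precomposition with a morphism of `C`. -/
def precomp (e : B ⟶ A) : Germ A Y → Germ B Y :=
  Quotient.map (fun p => ⟨p.1, e ≫ p.2⟩) fun p q ⟨l, u, v, h⟩ => ⟨l, u, v, by simp [h]⟩

@[simp] lemma precomp_mk (e : B ⟶ A) (j : Y.I) (f : A ⟶ Y.F.obj j) :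
    precomp e (mk j f) = mk j (e ≫ f) := rfl

@[simp] lemma precomp_id (g : Germ A Y) : precomp (𝟙 A) g = g := by
  obtain ⟨j, f, rfl⟩ := g.exists_rep
  simp

@[simp] lemma precomp_precomp {D : C} (e : B ⟶ A) (e' : D ⟶ B) (g : Germ A Y) :
    precomp e' (precomp e g) = precomp (e' ≫ e) g := by
  obtain ⟨j, f, rfl⟩ := g.exists_rep
  simp

end Germ

/-- Morphisms of ind-objects: the elements of `lim_i colim_j Hom(X i, Y j)`. -/
@[ext] structure Hom (X Y : IndObj C) : Type u where
  germ : ∀ i : X.I, Germ (X.F.obj i) Y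
  compat : ∀ {i i' : X.I} (u : i ⟶ i'), (germ i').precomp (X.F.map u) = germ i

namespace Germ

variable {A B : C} {X Y Z : IndObj C}

/-- Composition `colim_j Hom(A, Y j) × Hom(Y, Z) → colim_l Hom(A, Z l)`. -/
def bind (g : Germ A Y) (b : Hom Y Z) : Germ A Z :=
  Quotient.lift (fun p : Σ j : Y.I, (A ⟶ Y.F.obj j) => (b.germ p.1).precomp p.2) (by
    rintro ⟨j, f⟩ ⟨j', f'⟩ ⟨l, u, v, h⟩
    dsimp only at u v h ⊢
    rw [← b.compat u, ← b.compat v, precomp_precomp, precomp_precomp, h]) g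

@[simp] lemma bind_mk (j : Y.I) (f : A ⟶ Y.F.obj j) (b : Hom Y Z) :
    (mk j f).bind b = (b.germ j).precomp f := rfl

lemma precomp_bind (e : B ⟶ A) (g : Germ A Y) (b : Hom Y Z) :
    (g.precomp e).bind b = (g.bind b).precomp e := by
  obtain ⟨j, f, rfl⟩ := g.exists_rep
  simp

end Germ

instance : Category (IndObj C) where
  Hom := Hom
  id X :=
    { germ := fun i => .mk i (𝟙 _)
      compat := fun {i i'} u => Germ.mk_eq_mk.2 ⟨i', 𝟙 i', u, by simp⟩ }
  comp a b :=
    { germ := fun i => (a.germ i).bind b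
      compat := fun u => by rw [← Germ.precomp_bind, a.compat u] }
  id_comp a := Hom.ext (funext fun i => by simp)
  comp_id a := Hom.ext (funext fun i => by
    obtain ⟨j, f, h⟩ := (a.germ i).exists_rep
    simp [h])
  assoc a b d := Hom.ext (funext fun i => by
    obtain ⟨j, f, h⟩ := (a.germ i).exists_rep
    simp [h, Germ.precomp_bind])

@[ext] lemma hom_ext {X Y : IndObj C} {a b : X ⟶ Y} (h : ∀ i, Hom.germ a i = Hom.germ b i) :
    a = b :=
  Hom.ext (funext h)

@[simp] lemma id_germ (X : IndObj C) (i : X.I) : Hom.germ (𝟙 X) i = .mk i (𝟙 _) := rfl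

@[simp] lemma comp_germ {X Y Z : IndObj C} (a : X ⟶ Y) (b : Y ⟶ Z) (i : X.I) :
    Hom.germ (a ≫ b) i = (Hom.germ a i).bind b := rfl

/-- A functor `C ⥤ D` applied to formal filtered colimits: `"colim" X i ↦ "colim" G (X i)`. -/
def mapFunctor {D : Type (u + 1)} [Category.{u} D] (G : C ⥤ D) : IndObj C ⥤ IndObj D where
  obj X := { I := X.I, F := X.F ⋙ G }
  map {X Y} a :=
    { germ := fun i => Quotient.map (sa := germSetoid _ Y)
        (sb := germSetoid _ { I := Y.I, F := Y.F ⋙ G : IndObj D })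
        (fun p => ⟨p.1, G.map p.2⟩) (fun p q ⟨l, u, v, h⟩ => ⟨l, u, v, by
          simp only [Functor.comp_map, ← G.map_comp, h]⟩) (Hom.germ a i)
      compat := fun {i i'} u => by
        rw [← Hom.compat a u]
        obtain ⟨j, f, h⟩ := (Hom.germ a i').exists_rep
        rw [h]
        exact congrArg (Germ.mk _) (G.map_comp _ _).symm }
  map_id X := hom_ext fun i => congrArg (Germ.mk _) (G.map_id _)
  map_comp {X Y Z} a b := hom_ext fun i => by
    rw [comp_germ]
    dsimp only
    rw [comp_germ]
    obtain ⟨j, f, h⟩ := (Hom.germ a i).exists_rep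
    obtain ⟨l, g, h'⟩ := (Hom.germ b j).exists_rep
    rw [h, Germ.bind_mk, h', Germ.precomp_mk]
    refine (congrArg (Germ.mk (Y := { I := Z.I, F := Z.F ⋙ G }) l) (G.map_comp f g)).trans ?_
    refine Eq.trans ?_ (Germ.bind_mk (Y := { I := Y.I, F := Y.F ⋙ G }) j (G.map f) _).symm
    dsimp only
    rw [h']
    rfl

/-- The ind-object given by the constant diagram at `V` on a point. -/
def const (V : C) : IndObj C where
  I := Discrete PUnit
  F := (Functor.const _).obj V

/-! #### The tensor product of ind-objects -/

/-- A morphism of ind-objects given by morphisms of `C` along a functor of index categories. -/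
def level {X Y : IndObj C} (φ : X.I ⥤ Y.I) (f : X.F ⟶ φ ⋙ Y.F) : X ⟶ Y where
  germ i := .mk (φ.obj i) (f.app i)
  compat {i i'} u := Germ.mk_eq_mk.2 ⟨φ.obj i', 𝟙 _, φ.map u, by simp⟩

section Monoidal

variable [MonoidalCategory C]

/-- `("colim" X i) ⊗ ("colim" Y j) = "colim" (X i ⊗ Y j)`. -/
def tensor (X Y : IndObj C) : IndObj C where
  I := X.I × Y.I
  F := X.F.prod Y.F ⋙ MonoidalCategory.tensor C

/-- Tensor product of classes of morphisms. -/
def Germ.tensor {A B : C} {X Y : IndObj C} (g : Germ A X) (h : Germ B Y) :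
    Germ (A ⊗ B) (IndObj.tensor X Y) :=
  Quotient.map₂ (sa := germSetoid A X) (sb := germSetoid B Y)
    (sc := germSetoid (A ⊗ B) (IndObj.tensor X Y))
    (fun p q => ⟨(p.1, q.1), p.2 ⊗ₘ q.2⟩)
    (fun p p' ⟨l, u, v, e⟩ q q' ⟨l', u', v', e'⟩ => ⟨(l, l'), (u, u'), (v, v'), by
      change (p.2 ⊗ₘ q.2) ≫ (X.F.map u ⊗ₘ Y.F.map u') = (p'.2 ⊗ₘ q'.2) ≫ (X.F.map v ⊗ₘ Y.F.map v')
      simp only [tensorHom_comp_tensorHom, e, e']⟩) g h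

@[simp] lemma Germ.tensor_mk {A B : C} {X Y : IndObj C} (i : X.I) (f : A ⟶ X.F.obj i)
    (j : Y.I) (g : B ⟶ Y.F.obj j) :
    (Germ.mk i f).tensor (Germ.mk j g) = Germ.mk (Y := IndObj.tensor X Y) (i, j) (f ⊗ₘ g) := rfl

lemma Germ.precomp_tensor {A B A' B' : C} {X Y : IndObj C} (e : A' ⟶ A) (e' : B' ⟶ B)
    (g : Germ A X) (h : Germ B Y) :
    (g.tensor h).precomp (e ⊗ₘ e') = (g.precomp e).tensor (h.precomp e') := by
  obtain ⟨i, f, rfl⟩ := g.exists_rep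
  obtain ⟨j, f', rfl⟩ := h.exists_rep
  exact congrArg (Germ.mk (Y := IndObj.tensor X Y) (i, j)) (tensorHom_comp_tensorHom e e' f f')

/-- The tensor product of morphisms of ind-objects. -/
def tensorMap {X X' Y Y' : IndObj C} (a : X ⟶ X') (b : Y ⟶ Y') : tensor X Y ⟶ tensor X' Y' where
  germ p := (Hom.germ a p.1).tensor (Hom.germ b p.2)
  compat {p q} u := by
    rw [← Hom.compat a u.1, ← Hom.compat b u.2]
    exact Germ.precomp_tensor _ _ _ _

lemma tensorMap_germ {X X' Y Y' : IndObj C} (a : X ⟶ X') (b : Y ⟶ Y') (i : X.I) (j : Y.I) :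
    Hom.germ (tensorMap a b) (i, j) = (Hom.germ a i).tensor (Hom.germ b j) := rfl

/-- The associativity isomorphism of ind-objects. -/
def associator (X Y Z : IndObj C) : tensor (tensor X Y) Z ≅ tensor X (tensor Y Z) where
  hom := level (CategoryTheory.prod.associator X.I Y.I Z.I)
    { app := fun i => (α_ (X.F.obj i.1.1) (Y.F.obj i.1.2) (Z.F.obj i.2)).hom
      naturality := fun _ _ u =>
        associator_naturality (X.F.map u.1.1) (Y.F.map u.1.2) (Z.F.map u.2) }
  inv := level (CategoryTheory.prod.inverseAssociator X.I Y.I Z.I)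
    { app := fun i => (α_ (X.F.obj i.1) (Y.F.obj i.2.1) (Z.F.obj i.2.2)).inv
      naturality := fun _ _ u =>
        associator_inv_naturality (X.F.map u.1) (Y.F.map u.2.1) (Z.F.map u.2.2) }
  hom_inv_id := hom_ext fun i => congrArg (Germ.mk (Y := tensor (tensor X Y) Z) i)
    (α_ _ _ _).hom_inv_id
  inv_hom_id := hom_ext fun i => congrArg (Germ.mk (Y := tensor X (tensor Y Z)) i)
    (α_ _ _ _).inv_hom_id

/-- The left unit isomorphism of ind-objects. -/
def leftUnitor (X : IndObj C) : tensor (const (𝟙_ C)) X ≅ X where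
  hom := level (CategoryTheory.Prod.snd _ _)
    { app := fun i => (λ_ (X.F.obj i.2)).hom
      naturality := fun _ _ u => (by
        change (𝟙 (𝟙_ C) ⊗ₘ X.F.map u.2) ≫ _ = _ ≫ X.F.map u.2
        simp) }
  inv := level (CategoryTheory.Prod.sectR (Discrete.mk PUnit.unit) X.I)
    { app := fun i => (λ_ (X.F.obj i)).inv
      naturality := fun _ _ u => (by
        change X.F.map u ≫ _ = _ ≫ (𝟙 (𝟙_ C) ⊗ₘ X.F.map u)
        simp) }
  hom_inv_id := hom_ext fun i => congrArg (Germ.mk (Y := tensor (const (𝟙_ C)) X) i)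
    (λ_ _).hom_inv_id
  inv_hom_id := hom_ext fun i => congrArg (Germ.mk i) (λ_ _).inv_hom_id

/-- The right unit isomorphism of ind-objects. -/
def rightUnitor (X : IndObj C) : tensor X (const (𝟙_ C)) ≅ X where
  hom := level (CategoryTheory.Prod.fst _ _)
    { app := fun i => (ρ_ (X.F.obj i.1)).hom
      naturality := fun _ _ u => (by
        change (X.F.map u.1 ⊗ₘ 𝟙 (𝟙_ C)) ≫ _ = _ ≫ X.F.map u.1
        simp) }
  inv := level (CategoryTheory.Prod.sectL X.I (Discrete.mk PUnit.unit))
    { app := fun i => (ρ_ (X.F.obj i)).inv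
      naturality := fun _ _ u => (by
        change X.F.map u ≫ _ = _ ≫ (X.F.map u ⊗ₘ 𝟙 (𝟙_ C))
        simp) }
  hom_inv_id := hom_ext fun i => congrArg (Germ.mk (Y := tensor X (const (𝟙_ C))) i)
    (ρ_ _).hom_inv_id
  inv_hom_id := hom_ext fun i => congrArg (Germ.mk i) (ρ_ _).inv_hom_id

lemma leftUnitor_aux {A B : C} (f : A ⟶ B) :
    (𝟙 (𝟙_ C) ⊗ₘ f) ≫ (λ_ B).hom = (λ_ A).hom ≫ f := by simp

lemma rightUnitor_aux {A B : C} (f : A ⟶ B) :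
    (f ⊗ₘ 𝟙 (𝟙_ C)) ≫ (ρ_ B).hom = (ρ_ A).hom ≫ f := by simp

lemma pentagon_aux (A B D E : C) :
    ((α_ A B D).hom ⊗ₘ 𝟙 E) ≫ (α_ A (B ⊗ D) E).hom ≫ (𝟙 A ⊗ₘ (α_ B D E).hom) =
      (α_ (A ⊗ B) D E).hom ≫ (α_ A B (D ⊗ E)).hom := by simp

lemma triangle_aux (A B : C) :
    (α_ A (𝟙_ C) B).hom ≫ (𝟙 A ⊗ₘ (λ_ B).hom) = (ρ_ A).hom ⊗ₘ 𝟙 B := by simp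

instance : MonoidalCategoryStruct (IndObj C) where
  tensorObj := tensor
  whiskerLeft X _ _ b := tensorMap (𝟙 X) b
  whiskerRight a Y := tensorMap a (𝟙 Y)
  tensorHom := tensorMap
  tensorUnit := const (𝟙_ C)
  associator := associator
  leftUnitor := leftUnitor
  rightUnitor := rightUnitor

instance : MonoidalCategory (IndObj C) :=
  MonoidalCategory.ofTensorHom
    (id_tensorHom_id := fun X Y => hom_ext fun i =>
      congrArg (Germ.mk (Y := tensor X Y) i) (id_tensorHom_id _ _))
    (id_tensorHom := fun _ _ _ _ => rfl)
    (tensorHom_id := fun _ _ => rfl)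
    (tensorHom_comp_tensorHom := fun {X₁ Y₁ Z₁ X₂ Y₂ Z₂} f₁ f₂ g₁ g₂ => hom_ext fun ⟨i, j⟩ => by
      change ((Hom.germ f₁ i).tensor (Hom.germ f₂ j)).bind (tensorMap g₁ g₂) =
        ((Hom.germ f₁ i).bind g₁).tensor ((Hom.germ f₂ j).bind g₂)
      obtain ⟨i', f, h⟩ := (Hom.germ f₁ i).exists_rep
      obtain ⟨j', f', h'⟩ := (Hom.germ f₂ j).exists_rep
      rw [h, h', Germ.bind_mk, Germ.bind_mk]
      exact Germ.precomp_tensor _ _ _ _)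
    (associator_naturality := fun {X₁ X₂ X₃ Y₁ Y₂ Y₃} f₁ f₂ f₃ => hom_ext fun ⟨⟨i, j⟩, l⟩ => by
      change (((Hom.germ f₁ i).tensor (Hom.germ f₂ j)).tensor (Hom.germ f₃ l)).bind
          (associator Y₁ Y₂ Y₃).hom =
        Germ.precomp (α_ (X₁.F.obj i) (X₂.F.obj j) (X₃.F.obj l)).hom
          ((Hom.germ f₁ i).tensor ((Hom.germ f₂ j).tensor (Hom.germ f₃ l)))
      obtain ⟨i', f, h⟩ := (Hom.germ f₁ i).exists_rep
      obtain ⟨j', f', h'⟩ := (Hom.germ f₂ j).exists_rep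
      obtain ⟨l', f'', h''⟩ := (Hom.germ f₃ l).exists_rep
      rw [h, h', h'']
      exact congrArg (Germ.mk (Y := tensor Y₁ (tensor Y₂ Y₃)) (i', (j', l')))
        (associator_naturality f f' f''))
    (leftUnitor_naturality := fun {X Y} f => hom_ext fun ⟨p, i⟩ => by
      change ((Germ.mk (Y := const (𝟙_ C)) p (𝟙 _)).tensor (Hom.germ f i)).bind
          (leftUnitor Y).hom = (Hom.germ f i).precomp (λ_ (X.F.obj i)).hom
      obtain ⟨i', f, h⟩ := (Hom.germ f i).exists_rep
      rw [h]
      exact congrArg (Germ.mk i') (leftUnitor_aux f))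
    (rightUnitor_naturality := fun {X Y} f => hom_ext fun ⟨i, p⟩ => by
      change ((Hom.germ f i).tensor (Germ.mk (Y := const (𝟙_ C)) p (𝟙 _))).bind
          (rightUnitor Y).hom = (Hom.germ f i).precomp (ρ_ (X.F.obj i)).hom
      obtain ⟨i', f, h⟩ := (Hom.germ f i).exists_rep
      rw [h]
      exact congrArg (Germ.mk i') (rightUnitor_aux f))
    (pentagon := fun X Y Z W => hom_ext fun ⟨⟨⟨i, j⟩, l⟩, m⟩ =>
      congrArg (Germ.mk (Y := tensor X (tensor Y (tensor Z W))) (i, (j, (l, m))))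
        (pentagon_aux (X.F.obj i) (Y.F.obj j) (Z.F.obj l) (W.F.obj m)))
    (triangle := fun X Y => hom_ext fun ⟨⟨i, p⟩, j⟩ =>
      congrArg (Germ.mk (Y := tensor X Y) (i, j))
        (triangle_aux (X.F.obj i) (Y.F.obj j)))

end Monoidal

end IndObj

/-- The category of ind-Banach spaces over `k`. -/
abbrev IndBan {k : Type u} [NontriviallyNormedField k] (c : BanachConvention k) : Type (u + 1) :=
  IndObj (Ban c)

namespace IndObj

lemma Germ.exists_rep₂ {C : Type (u + 1)} [Category.{u} C] {A B : C} {Y : IndObj C}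
    (g : Germ A Y) (h : Germ B Y) : ∃ j f f', g = .mk j f ∧ h = .mk j f' := by
  obtain ⟨j, f, rfl⟩ := g.exists_rep
  obtain ⟨j', f', rfl⟩ := h.exists_rep
  exact ⟨IsFiltered.max j j', f ≫ Y.F.map (IsFiltered.leftToMax j j'),
    f' ≫ Y.F.map (IsFiltered.rightToMax j j'), (Germ.mk_map _ _).symm, (Germ.mk_map _ _).symm⟩

lemma Germ.exact₂ {C : Type (u + 1)} [Category.{u} C] {A B : C} {Y : IndObj C} {j j' : Y.I}
    {f : A ⟶ Y.F.obj j} {f' : A ⟶ Y.F.obj j'} {g : B ⟶ Y.F.obj j} {g' : B ⟶ Y.F.obj j'}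
    (hf : Germ.mk j f = .mk j' f') (hg : Germ.mk j g = .mk j' g') :
    ∃ w : Σ l : Y.I, (j ⟶ l) × (j' ⟶ l), f ≫ Y.F.map w.2.1 = f' ≫ Y.F.map w.2.2 ∧
      g ≫ Y.F.map w.2.1 = g' ≫ Y.F.map w.2.2 := by
  obtain ⟨l, u, v, e⟩ := Germ.mk_eq_mk.1 hf
  obtain ⟨l', u', v', e'⟩ := Germ.mk_eq_mk.1 hg
  obtain ⟨s, a, b, h1, h2⟩ := IsFiltered.bowtie u u' v v'
  refine ⟨⟨s, u ≫ a, v ≫ a⟩, ?_, ?_⟩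
  · simp only [Functor.map_comp, reassoc_of% e]
  · dsimp only
    rw [h1, h2, Functor.map_comp, Functor.map_comp, reassoc_of% e']

end IndObj

/-! ### Internal homs of ind-Banach spaces

The internal hom is `lim_i "colim"_j Hom(X i, Y j)`. It is presented here as a formal filtered
colimit of explicit Banach spaces of compatible families of bounded linear maps. -/

namespace IndBan

open IndObj

variable {k : Type u} [NontriviallyNormedField k] {c : BanachConvention k}

section

variable (X Y : IndBan c)

/-- Indices for the internal hom: a target index `φ i` and a scaling factor `r i` for every `i`,
and, for every arrow `i ⟶ i'`, a place where compatibility is required to hold. -/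
structure HomIndex : Type u where
  φ : X.I → Y.I
  r : X.I → k
  w : ∀ {i i' : X.I} (_ : i ⟶ i'), Σ l : Y.I, (φ i ⟶ l) × (φ i' ⟶ l)

variable {X Y}

namespace HomIndex

variable (p : HomIndex X Y)

/-- Uniformly bounded families of bounded linear maps `X i → Y (φ i)`. -/
abbrev Bdd : Type u := lp (fun i : X.I => X.F.obj i →L[k] Y.F.obj (p.φ i)) ⊤

/-- The compatibility defect of a family along an arrow. -/
def defect {i i' : X.I} (u : i ⟶ i') : p.Bdd →L[k] (X.F.obj i →L[k] Y.F.obj (p.w u).1) :=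
  p.r i • (ContinuousLinearMap.compL k _ _ _ (Ban.Hom.clm (Y.F.map (p.w u).2.1))).comp
      (lp.evalCLM k (fun i : X.I => X.F.obj i →L[k] Y.F.obj (p.φ i)) ⊤ i) -
    p.r i' • ((ContinuousLinearMap.compL k _ _ _).flip (Ban.Hom.clm (X.F.map u))).comp
      ((ContinuousLinearMap.compL k _ _ _ (Ban.Hom.clm (Y.F.map (p.w u).2.2))).comp
        (lp.evalCLM k (fun i : X.I => X.F.obj i →L[k] Y.F.obj (p.φ i)) ⊤ i'))

lemma defect_apply {i i' : X.I} (u : i ⟶ i') (v : p.Bdd) (x : X.F.obj i) :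
    p.defect u v x = p.r i • Ban.Hom.clm (Y.F.map (p.w u).2.1) (v i x) -
      p.r i' • Ban.Hom.clm (Y.F.map (p.w u).2.2) (v i' (Ban.Hom.clm (X.F.map u) x)) := rfl

/-- Uniformly bounded families `v` such that the maps `r i • v i` are compatible. -/
def sub : Submodule k p.Bdd where
  carrier := {v | ∀ (i i' : X.I) (u : i ⟶ i'), p.defect u v = 0}
  zero_mem' _ _ u := map_zero _
  add_mem' hv hw i i' u := by rw [map_add, hv, hw, add_zero]
  smul_mem' a v hv i i' u := by rw [map_smul, hv, smul_zero]

lemma isClosed_sub : IsClosed (p.sub : Set p.Bdd) := by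
  have : (p.sub : Set p.Bdd) =
      ⋂ (i : X.I) (i' : X.I) (u : i ⟶ i'), {v | p.defect u v = 0} := by
    ext v
    simp only [Set.mem_iInter]
    rfl
  rw [this]
  exact isClosed_iInter fun i => isClosed_iInter fun i' => isClosed_iInter fun u =>
    isClosed_eq (p.defect u).continuous continuous_const

/-- The Banach space attached to an index. -/
def space : Ban c where
  carrier := p.sub
  completeSpace := p.isClosed_sub.completeSpace_coe
  admits := by
    rw [c.admits_iff]
    intro v w
    refine lp.norm_le_of_forall_le (c.add_nonneg' (norm_nonneg v) (norm_nonneg w)) fun i => ?_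
    refine ((Ban.hom (X.F.obj i) (Y.F.obj (p.φ i))).norm_add (v.1 i) (w.1 i)).trans ?_
    exact c.add_mono (lp.norm_apply_le_norm ENNReal.top_ne_zero v.1 i)
      (lp.norm_apply_le_norm ENNReal.top_ne_zero w.1 i)

/-- The bounded linear map `v ↦ r i • v i`. -/
def proj (i : X.I) : p.space ⟶ Ban.hom (X.F.obj i) (Y.F.obj (p.φ i)) :=
  Ban.ofClm (V := p.space) (W := Ban.hom (X.F.obj i) (Y.F.obj (p.φ i)))
    (p.r i • (lp.evalCLM k (fun i : X.I => X.F.obj i →L[k] Y.F.obj (p.φ i)) ⊤ i).comp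
      p.sub.subtypeL)

end HomIndex

variable [CompleteSpace k] (X Y)

/-- The elements of `lim_i colim_j Hom(X i ⊗ U, Y j)`, for a Banach space `U`. -/
@[ext] structure Fam (U : Ban c) : Type u where
  germ : ∀ i : X.I, Germ (X.F.obj i ⊗ U) Y
  compat : ∀ {i i' : X.I} (u : i ⟶ i'), (germ i').precomp (X.F.map u ▷ U) = germ i

variable {X Y} in
/-- Precomposition with a bounded linear map. -/
def Fam.pre {U U' : Ban c} (T : U ⟶ U') (h : Fam X Y U') : Fam X Y U where
  germ i := (h.germ i).precomp (X.F.obj i ◁ T)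
  compat u := by
    rw [← h.compat u, Germ.precomp_precomp, Germ.precomp_precomp, whisker_exchange]

variable {X Y} in
lemma Fam.pre_pre {U U' U'' : Ban c} (T : U ⟶ U') (T' : U' ⟶ U'') (h : Fam X Y U'') :
    (h.pre T').pre T = h.pre (T ≫ T') :=
  Fam.ext (funext fun i => by simp [Fam.pre])

variable {X Y} in
lemma Fam.pre_id {U : Ban c} (h : Fam X Y U) : h.pre (𝟙 U) = h :=
  Fam.ext (funext fun i => by simp [Fam.pre])

variable {X Y}

namespace HomIndex

variable (p : HomIndex X Y)

lemma uncurry_proj_tmul (i : X.I) (x : X.F.obj i) (v : p.space) :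
    Ban.Hom.clm (Ban.uncurry (p.proj i)) (Ban.tmul _ _ x v) = p.r i • v.1 i x :=
  Ban.uncurry_tmul _ _ _

/-- The tautological family on the Banach space attached to an index. -/
def fam : Fam X Y p.space where
  germ i := .mk (p.φ i) (Ban.uncurry (p.proj i))
  compat {i i'} u := by
    refine Germ.mk_eq_mk.2 ⟨(p.w u).1, (p.w u).2.2, (p.w u).2.1, Ban.tensor_hom_ext fun x v => ?_⟩
    have h := congrArg (fun f : X.F.obj i →L[k] Y.F.obj (p.w u).1 => f x) (v.2 i i' u)
    have h' := sub_eq_zero.1 ((p.defect_apply u v.1 x).symm.trans h)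
    have a1 := (congrArg (Ban.Hom.clm (Ban.uncurry (p.proj i')))
      (Ban.whiskerRight_tmul (X.F.map u) x v)).trans (p.uncurry_proj_tmul i' _ v)
    have a2 := p.uncurry_proj_tmul i x v
    exact (congrArg (Ban.Hom.clm (Y.F.map (p.w u).2.2)) a1).trans ((map_smul _ _ _).trans
      (h'.symm.trans ((map_smul _ _ _).symm.trans
        (congrArg (Ban.Hom.clm (Y.F.map (p.w u).2.1)) a2.symm))))

/-- A compatible family of bounded linear maps, bounded by the scaling factors, factors through
the Banach space attached to an index. -/
lemma exists_factor {U : Ban c} (f : ∀ i, X.F.obj i ⊗ U ⟶ Y.F.obj (p.φ i))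
    (hr : ∀ i, p.r i ≠ 0) (hf : ∀ i, ‖Ban.Hom.clm (Ban.curry (f i))‖ ≤ ‖p.r i‖)
    (hw : ∀ {i i' : X.I} (u : i ⟶ i'), f i ≫ Y.F.map (p.w u).2.1 =
      (X.F.map u ▷ U ≫ f i') ≫ Y.F.map (p.w u).2.2) :
    ∃ S : U ⟶ p.space, (∀ i, (p.fam.pre S).germ i = .mk (p.φ i) (f i)) ∧
      ∀ y i, (Ban.Hom.clm S y).1 i = (p.r i)⁻¹ • Ban.Hom.clm (Ban.curry (f i)) y := by
  have hb : ∀ (y : U) (i : X.I),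
      ‖(p.r i)⁻¹ • (show X.F.obj i →L[k] Y.F.obj (p.φ i) from
        Ban.Hom.clm (Ban.curry (f i)) y)‖ ≤ ‖y‖ := by
    intro y i
    rw [norm_smul, norm_inv, inv_mul_le_iff₀ (norm_pos_iff.2 (hr i))]
    exact (Ban.Hom.clm (Ban.curry (f i))).le_of_opNorm_le (hf i) y
  let v : U → p.Bdd := fun y =>
    ⟨fun i => (p.r i)⁻¹ • (show X.F.obj i →L[k] Y.F.obj (p.φ i) from
        Ban.Hom.clm (Ban.curry (f i)) y), memℓp_infty ⟨‖y‖, by rintro _ ⟨i, rfl⟩; exact hb y i⟩⟩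
  have hv : ∀ y, v y ∈ p.sub := by
    intro y i i' u
    refine ContinuousLinearMap.ext fun x => ?_
    rw [defect_apply]
    have e : Ban.Hom.clm (Y.F.map (p.w u).2.1) (Ban.Hom.clm (f i) (Ban.tmul _ _ x y)) =
        Ban.Hom.clm (Y.F.map (p.w u).2.2)
          (Ban.Hom.clm (f i') (Ban.tmul _ _ (Ban.Hom.clm (X.F.map u) x) y)) :=
      (congrArg (fun F => Ban.Hom.clm F (Ban.tmul _ _ x y)) (hw u)).trans
        (congrArg (fun t => Ban.Hom.clm (Y.F.map (p.w u).2.2) (Ban.Hom.clm (f i') t))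
          (Ban.whiskerRight_tmul (X.F.map u) x y))
    have e1 : v y i x = (p.r i)⁻¹ • Ban.Hom.clm (f i) (Ban.tmul _ _ x y) := rfl
    have e2 : v y i' (Ban.Hom.clm (X.F.map u) x) = (p.r i')⁻¹ •
      Ban.Hom.clm (f i') (Ban.tmul _ _ (Ban.Hom.clm (X.F.map u) x) y) := rfl
    rw [e1, e2, map_smul, map_smul, smul_inv_smul₀ (hr i), smul_inv_smul₀ (hr i'), e, sub_self]
    rfl
  let S : U →L[k] p.space := LinearMap.mkContinuous
    { toFun := fun y => (⟨v y, hv y⟩ : p.sub)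
      map_add' := fun y z => Subtype.ext (lp.ext (funext fun i => by
        exact (congrArg (fun g => (p.r i)⁻¹ • g)
          (map_add (Ban.Hom.clm (Ban.curry (f i))) y z)).trans (smul_add _ _ _)))
      map_smul' := fun a y => Subtype.ext (lp.ext (funext fun i => by
        exact (congrArg (fun g => (p.r i)⁻¹ • g)
          (map_smul (Ban.Hom.clm (Ban.curry (f i))) a y)).trans (by
            rw [RingHom.id_apply]
            exact smul_comm (p.r i)⁻¹ a (Ban.Hom.clm (Ban.curry (f i)) y)))) } 1 fun y => by
    rw [one_mul]
    exact lp.norm_le_of_forall_le (norm_nonneg y) fun i => hb y i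
  refine ⟨Ban.ofClm S, fun i => congrArg (Germ.mk (p.φ i)) (Ban.tensor_hom_ext fun x y => ?_),
    fun y i => rfl⟩
  exact (congrArg (Ban.Hom.clm (Ban.uncurry (p.proj i)))
      (Ban.whiskerLeft_tmul (Ban.ofClm S) x y)).trans ((p.uncurry_proj_tmul i x (S y)).trans
    (smul_inv_smul₀ (hr i) (Ban.Hom.clm (f i) (Ban.tmul _ _ x y))))

end HomIndex

lemma exists_factor₂ {U U' : Ban c} (h : Fam X Y U) (h' : Fam X Y U') (φ : X.I → Y.I)
    (f : ∀ i, X.F.obj i ⊗ U ⟶ Y.F.obj (φ i)) (f' : ∀ i, X.F.obj i ⊗ U' ⟶ Y.F.obj (φ i))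
    (hf : ∀ i, h.germ i = .mk (φ i) (f i)) (hf' : ∀ i, h'.germ i = .mk (φ i) (f' i)) :
    ∃ (p : HomIndex X Y) (S : U ⟶ p.space) (S' : U' ⟶ p.space),
      p.fam.pre S = h ∧ p.fam.pre S' = h' ∧
      ∀ y z, (∀ i, Ban.Hom.clm (Ban.curry (f i)) y = Ban.Hom.clm (Ban.curry (f i)) z) →
        Ban.Hom.clm S y = Ban.Hom.clm S z := by
  choose r hr using fun i => NormedField.exists_lt_norm k
    (‖Ban.Hom.clm (Ban.curry (f i))‖ + ‖Ban.Hom.clm (Ban.curry (f' i))‖)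
  have hw : ∀ {i i' : X.I} (u : i ⟶ i'), ∃ w : Σ l : Y.I, (φ i ⟶ l) × (φ i' ⟶ l),
      f i ≫ Y.F.map w.2.1 = (X.F.map u ▷ U ≫ f i') ≫ Y.F.map w.2.2 ∧
      f' i ≫ Y.F.map w.2.1 = (X.F.map u ▷ U' ≫ f' i') ≫ Y.F.map w.2.2 := by
    intro i i' u
    refine Germ.exact₂ ?_ ?_
    · rw [← Germ.precomp_mk, ← hf, ← hf, h.compat]
    · rw [← Germ.precomp_mk, ← hf', ← hf', h'.compat]
  choose w hw1 hw2 using @hw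
  let p : HomIndex X Y := ⟨φ, r, w⟩
  have hr0 : ∀ i, r i ≠ 0 := fun i => norm_pos_iff.1 ((by positivity : (0 : ℝ) ≤
    ‖Ban.Hom.clm (Ban.curry (f i))‖ + ‖Ban.Hom.clm (Ban.curry (f' i))‖).trans_lt (hr i))
  obtain ⟨S, hS, hS'⟩ := p.exists_factor f hr0
    (fun i => (le_add_of_nonneg_right (norm_nonneg _)).trans (hr i).le) hw1
  obtain ⟨T, hT, -⟩ := p.exists_factor f' hr0
    (fun i => (le_add_of_nonneg_left (norm_nonneg _)).trans (hr i).le) hw2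
  refine ⟨p, S, T, Fam.ext (funext fun i => (hS i).trans (hf i).symm),
    Fam.ext (funext fun i => (hT i).trans (hf' i).symm), fun y z hyz => ?_⟩
  refine Subtype.ext (lp.ext (funext fun i => ?_))
  rw [hS' y i, hS' z i, hyz i]

lemma exists_common {U U' : Ban c} (h : Fam X Y U) (h' : Fam X Y U') :
    ∃ (p : HomIndex X Y) (S : U ⟶ p.space) (S' : U' ⟶ p.space),
      p.fam.pre S = h ∧ p.fam.pre S' = h' := by
  choose φ f f' hf hf' using fun i => (h.germ i).exists_rep₂ (h'.germ i)
  obtain ⟨p, S, S', h1, h2, -⟩ := exists_factor₂ h h' φ f f' hf hf'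
  exact ⟨p, S, S', h1, h2⟩

lemma exists_equalizing {U U' : Ban c} (T T' : U ⟶ U') (h : Fam X Y U')
    (hT : h.pre T = h.pre T') :
    ∃ (p : HomIndex X Y) (S : U' ⟶ p.space), p.fam.pre S = h ∧ T ≫ S = T' ≫ S := by
  have key : ∀ i, ∃ (j : Y.I) (f : X.F.obj i ⊗ U' ⟶ Y.F.obj j), h.germ i = .mk j f ∧
      X.F.obj i ◁ T ≫ f = X.F.obj i ◁ T' ≫ f := by
    intro i
    obtain ⟨j, f, hf⟩ := (h.germ i).exists_rep
    have e : (h.germ i).precomp (X.F.obj i ◁ T) = (h.germ i).precomp (X.F.obj i ◁ T') :=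
      congrArg (fun h : Fam X Y U => h.germ i) hT
    rw [hf] at e
    obtain ⟨l, u, v, e⟩ := Germ.mk_eq_mk.1 e
    refine ⟨IsFiltered.coeq u v, f ≫ Y.F.map (u ≫ IsFiltered.coeqHom u v),
      hf.trans (Germ.mk_map _ _).symm, ?_⟩
    conv_rhs => rw [IsFiltered.coeq_condition]
    simp only [Category.assoc] at e
    simp only [Functor.map_comp, reassoc_of% e]
  choose φ f hf hf' using key
  obtain ⟨p, S, S', h1, -, h3⟩ := exists_factor₂ h h φ f f hf hf
  refine ⟨p, S, h1, Ban.hom_ext fun y => h3 _ _ fun i => ContinuousLinearMap.ext fun x => ?_⟩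
  exact (congrArg (Ban.Hom.clm (f i)) (Ban.whiskerLeft_tmul T x y)).symm.trans
    ((congrArg (fun F => Ban.Hom.clm F (Ban.tmul _ _ x y)) (hf' i)).trans
      (congrArg (Ban.Hom.clm (f i)) (Ban.whiskerLeft_tmul T' x y)))

/-- A morphism of indices is a bounded linear map that respects the tautological families. -/
instance : SmallCategory (HomIndex X Y) where
  Hom p q := {T : p.space ⟶ q.space // q.fam.pre T = p.fam}
  id p := ⟨𝟙 _, p.fam.pre_id⟩
  comp T T' := ⟨T.1 ≫ T'.1, by rw [← Fam.pre_pre, T'.2, T.2]⟩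

instance : IsFiltered (HomIndex X Y) where
  nonempty :=
    let j : Y.I := Classical.choice (IsFiltered.nonempty (C := Y.I))
    ⟨⟨fun _ => j, fun _ => 1, fun _ => ⟨j, 𝟙 j, 𝟙 j⟩⟩⟩
  cocone_objs p q := by
    obtain ⟨s, S, S', h, h'⟩ := exists_common p.fam q.fam
    exact ⟨s, ⟨S, h⟩, ⟨S', h'⟩, trivial⟩
  cocone_maps p q T T' := by
    obtain ⟨s, S, h, h'⟩ := exists_equalizing T.1 T'.1 q.fam (T.2.trans T'.2.symm)
    exact ⟨s, ⟨S, h⟩, Subtype.ext h'⟩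

variable (X Y) in
/-- The internal hom of ind-Banach spaces. -/
def ihomObj : IndBan c where
  I := HomIndex X Y
  F :=
    { obj := fun p => p.space
      map := fun T => T.1 }

/-- Morphisms from a Banach space to the internal hom, as families. -/
def toFam {U : Ban c} : Germ U (ihomObj X Y) → Fam X Y U :=
  Quotient.lift (s := germSetoid U (ihomObj X Y))
    (fun p : Σ p : HomIndex X Y, (U ⟶ p.space) => p.1.fam.pre p.2) (by
    rintro ⟨p, S⟩ ⟨q, T⟩ ⟨l, u, v, h⟩
    change S ≫ u.1 = T ≫ v.1 at h
    exact (congrArg (Fam.pre S) u.2).symm.trans ((Fam.pre_pre S u.1 (HomIndex.fam l)).trans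
      ((congrArg (fun e => (HomIndex.fam l).pre e) h).trans
        ((Fam.pre_pre T v.1 (HomIndex.fam l)).symm.trans (congrArg (Fam.pre T) v.2)))))

lemma toFam_mk {U : Ban c} (p : HomIndex X Y) (S : U ⟶ p.space) :
    toFam (Germ.mk (Y := ihomObj X Y) p S) = p.fam.pre S := rfl

lemma toFam_precomp {U U' : Ban c} (T : U ⟶ U') (g : Germ U' (ihomObj X Y)) :
    toFam (g.precomp T) = (toFam g).pre T := by
  obtain ⟨p, S, rfl⟩ := g.exists_rep
  exact (Fam.pre_pre _ _ _).symm

lemma toFam_bijective (U : Ban c) : Function.Bijective (toFam (X := X) (Y := Y) (U := U)) := by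
  constructor
  · intro g g' h
    obtain ⟨p, S, S', rfl, rfl⟩ := g.exists_rep₂ g'
    obtain ⟨q, T, hT, e⟩ := exists_equalizing S S' p.fam h
    let t : p ⟶ q := ⟨T, hT⟩
    exact Germ.mk_eq_mk.2 ⟨q, t, t, e⟩
  · intro h
    obtain ⟨p, S, -, hS, -⟩ := exists_common h h
    exact ⟨Germ.mk (Y := ihomObj X Y) p S, hS⟩

/-- Morphisms from a Banach space to the internal hom are the same as families. -/
def famEquiv (U : Ban c) : Germ U (ihomObj X Y) ≃ Fam X Y U :=
  Equiv.ofBijective toFam (toFam_bijective U)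

lemma famEquiv_precomp {U U' : Ban c} (T : U ⟶ U') (g : Germ U' (ihomObj X Y)) :
    famEquiv U (g.precomp T) = (famEquiv U' g).pre T := toFam_precomp T g

lemma famEquiv_symm_pre {U U' : Ban c} (T : U ⟶ U') (h : Fam X Y U') :
    (famEquiv U).symm (h.pre T) = ((famEquiv U').symm h).precomp T := by
  rw [Equiv.symm_apply_eq, famEquiv_precomp, Equiv.apply_symm_apply]

variable {Z : IndBan c}

/-- The restriction of a morphism `X ⊗ Z ⟶ Y` to a constituent of `Z`. -/
def restrict (a : X ⊗ Z ⟶ Y) (z : Z.I) : Fam X Y (Z.F.obj z) where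
  germ i := Hom.germ a (i, z)
  compat {i i'} u := by
    refine Eq.trans ?_ (Hom.compat a (i := (i, z)) (i' := (i', z)) (u, 𝟙 z))
    refine congrArg (fun e => Germ.precomp e _) ?_
    change _ = X.F.map u ⊗ₘ Z.F.map (𝟙 z)
    simp

lemma restrict_pre (a : X ⊗ Z ⟶ Y) {z z' : Z.I} (v : z ⟶ z') :
    (restrict a z').pre (Z.F.map v) = restrict a z := by
  refine Fam.ext (funext fun i => ?_)
  refine Eq.trans ?_ (Hom.compat a (i := (i, z)) (i' := (i, z')) (𝟙 i, v))
  refine congrArg (fun e => Germ.precomp e _) ?_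
  change _ = X.F.map (𝟙 i) ⊗ₘ Z.F.map v
  simp

/-- The universal property of the internal hom. -/
def curryEquiv (X Z Y : IndBan c) : (X ⊗ Z ⟶ Y) ≃ (Z ⟶ ihomObj X Y) where
  toFun a :=
    { germ := fun z => (famEquiv _).symm (restrict a z)
      compat := fun v => by rw [← famEquiv_symm_pre, restrict_pre] }
  invFun b :=
    { germ := fun p => (famEquiv _ (Hom.germ b p.2)).germ p.1
      compat := fun {p q} u => by
        rw [← Hom.compat b u.2, famEquiv_precomp, ← Fam.compat _ u.1]
        refine Eq.trans ?_ (Germ.precomp_precomp _ _ _).symm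
        refine congrArg (fun e => Germ.precomp e _) ?_
        change X.F.map u.1 ⊗ₘ Z.F.map u.2 = _
        exact MonoidalCategory.tensorHom_def _ _ }
  left_inv a := hom_ext fun p => by
    dsimp only
    rw [Equiv.apply_symm_apply]
    rfl
  right_inv b := hom_ext fun z => by
    dsimp only
    rw [Equiv.symm_apply_eq]
    rfl

lemma curryEquiv_naturality (X : IndBan c) {Z Z' : IndBan c} (Y : IndBan c) (f : Z ⟶ Z')
    (g : X ⊗ Z' ⟶ Y) : curryEquiv X Z Y (X ◁ f ≫ g) = f ≫ curryEquiv X Z' Y g := by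
  refine hom_ext fun z => ?_
  rw [comp_germ]
  obtain ⟨z', t, h⟩ := (Hom.germ f z).exists_rep
  rw [h, Germ.bind_mk]
  change (famEquiv _).symm _ = ((famEquiv _).symm _).precomp t
  rw [← famEquiv_symm_pre]
  refine congrArg _ (Fam.ext (funext fun i => ?_))
  change ((Germ.mk i (𝟙 _)).tensor (Hom.germ f z)).bind g = _
  rw [h]
  change (Hom.germ g (i, z')).precomp (𝟙 _ ⊗ₘ t) = (Hom.germ g (i, z')).precomp _
  rw [id_tensorHom]
  rfl

end

/-- The category of ind-Banach spaces is closed monoidal. -/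
instance [CompleteSpace k] : MonoidalClosed (IndBan c) where
  closed X :=
    { rightAdj := Adjunction.rightAdjointOfEquiv (F := tensorLeft X) (curryEquiv X)
        fun _ _ Y f g => curryEquiv_naturality X Y f g
      adj := Adjunction.adjunctionOfEquivRight (F := tensorLeft X) (curryEquiv X)
        fun _ _ Y f g => curryEquiv_naturality X Y f g }

end IndBan

namespace IndBan

variable {k : Type u} [NontriviallyNormedField k] [CompleteSpace k] {c : BanachConvention k}

/-- The contracting coproduct of copies of one ind-Banach space indexed by `S`:
`"colim" X i ↦ "colim" (∐_S X i)`. -/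
def contractingCoprod (S : Type u) : IndBan c ⥤ IndBan c :=
  IndObj.mapFunctor (Ban.coprodFunctor S)

/-- The ind-Banach space `l¹(S) = ∐_S k`. -/
def l1 (S : Type u) (c : BanachConvention k) : IndBan c :=
  (contractingCoprod S).obj (𝟙_ (IndBan c))

/-- The canonical map `∐_S X ⟶ X ⊗ l¹(S)`, given by `(x s)_s ↦ ∑ s, x s ⊗ δ_s`. -/
def coprodToTensor (S : Type u) (X : IndBan c) : (contractingCoprod S).obj X ⟶ X ⊗ l1 S c :=
  IndObj.level (X := (contractingCoprod S).obj X) (Y := X ⊗ l1 S c)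
    (CategoryTheory.Prod.sectL X.I (Discrete.mk PUnit.unit))
    { app := fun i => (Ban.coprodToTensor S).app (X.F.obj i)
      naturality := fun i i' u => by
        refine ((Ban.coprodToTensor S).naturality (X.F.map u)).trans ?_
        refine congrArg (fun e => (Ban.coprodToTensor S).app (X.F.obj i) ≫ e) ?_
        change X.F.map u ▷ Ban.l1 S c =
          X.F.map u ⊗ₘ (Ban.coprodFunctor S).map (𝟙 (Ban.unit c))
        rw [CategoryTheory.Functor.map_id]
        exact (tensorHom_id _ _).symm }

open scoped MonoidalClosed in
/-- An enrichment over `IndBan` of an endofunctor `F` of `IndBan`, where `IndBan` is enriched over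
itself by its internal hom `(ihom X).obj Y`: morphisms between the hom objects that are compatible
with identities, with composition, and with the action of `F` on ordinary morphisms (which are the
morphisms from the unit object to the hom objects). -/
structure Enrichment (F : IndBan c ⥤ IndBan c) where
  map (X Y : IndBan c) :
    EnrichedCategory.Hom (V := IndBan c) X Y ⟶
      EnrichedCategory.Hom (V := IndBan c) (F.obj X) (F.obj Y)
  map_id (X : IndBan c) : eId (IndBan c) X ≫ map X X = eId (IndBan c) (F.obj X)
  map_comp (X Y Z : IndBan c) : eComp (IndBan c) X Y Z ≫ map X Z =
    (map X Y ⊗ₘ map Y Z) ≫ eComp (IndBan c) (F.obj X) (F.obj Y) (F.obj Z)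
  map_homEquiv {X Y : IndBan c} (f : X ⟶ Y) :
    eHomEquiv (IndBan c) f ≫ map X Y = eHomEquiv (IndBan c) (F.map f)

namespace Enrichment

variable {F : IndBan c ⥤ IndBan c} (E : Enrichment F)

/-- The natural map `∐_S F(k) ⟶ F(l¹(S))`. The family of the inclusions `k ⟶ l¹(S)`, which
corresponds to the identity of `l¹(S) = ∐_S k`, is the morphism `l¹(S) ⟶ Hom(k, l¹(S))`. The
enrichment sends it to `l¹(S) ⟶ Hom(F(k), F(l¹(S)))`, which corresponds to a morphism
`F(k) ⊗ l¹(S) ⟶ F(l¹(S))`, hence to a morphism from `∐_S F(k)`. -/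
def l1Comparison (S : Type u) :
    (contractingCoprod S).obj (F.obj (𝟙_ (IndBan c))) ⟶ F.obj (l1 S c) :=
  coprodToTensor S (F.obj (𝟙_ (IndBan c))) ≫
    MonoidalClosed.uncurry
      (MonoidalClosed.curry (λ_ (l1 S c)).hom ≫ E.map (𝟙_ (IndBan c)) (l1 S c))

/-- The functor, with its enrichment, commutes with `l¹`. -/
def CommutesWithL1 : Prop := ∀ S : Type u, IsIso (E.l1Comparison S)

end Enrichment

end IndBan

end

/-!
Both directions compare a functor `F` with `F(k) ⊗ -` through one natural transformation. An
enrichment of `F` gives `tensorLeftHom : F(k) ⊗ X ⟶ F(X)`, the transpose of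
`X ≅ Hom(k, X) ⟶ Hom(F(k), F(X))`, and the comparison map of `F` with `l¹(S)` is by definition its
component at `l¹(S)` preceded by the canonical map `∐_S F(k) ⟶ F(k) ⊗ l¹(S)`. The latter is always
invertible: on Banach spaces its inverse sends `x ⊗ (a s)_s` to `(a s • x)_s`. Hence `F` commutes
with `l¹` exactly when `tensorLeftHom` is invertible at every `l¹(S)`.

If `F ≅ V ⊗ -`, then `F` is a left adjoint up to isomorphism, hence cocontinuous, and it inherits
an enrichment from associativity of the tensor product; for this enrichment `tensorLeftHom` is a
composite of structural isomorphisms (`isIso_tensorLeftHom_app_ofIsoTensorLeft`).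

Conversely, let `F` be cocontinuous. Since `F(k) ⊗ -` is cocontinuous as well, `tensorLeftHom` is
invertible as soon as it is so at the objects `l¹(S)`, because these generate all ind-Banach spaces
under colimits (`IndBan.isIso_of_isIso_app_l1`). Every Banach space is a quotient of `l¹` of its
unit ball, and so is the kernel of this quotient map; by the open mapping theorem the Banach space
is then the cokernel of a map `l¹(T) ⟶ l¹(S)` (`Ban.exists_l1_presentation`). Constant diagrams
preserve such cokernels (`IndObj.isColimit_cofork_const`), and every ind-object is the colimit of
constant ones (`IndObj.isColimitConstCocone`).
-/

noncomputable section

open scoped MonoidalClosed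

/-! ### Internal homs and functors isomorphic to `V ⊗ -` -/

namespace CategoryTheory

namespace MonoidalClosed

universe v w

variable {C : Type w} [Category.{v} C] [MonoidalCategory C] [MonoidalClosed C]
  {F : C ⥤ C} {V : C}

/-- The action on internal homs of a functor `F` isomorphic to `V ⊗ -`: the transpose of
`F X ⊗ Hom(X, Y) ≅ V ⊗ (X ⊗ Hom(X, Y)) ⟶ V ⊗ Y ≅ F Y`. -/
def tensorLeftIhomMap (α : F ≅ tensorLeft V) (X Y : C) :
    (ihom X).obj Y ⟶ (ihom (F.obj X)).obj (F.obj Y) :=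
  curry (α.hom.app X ▷ _ ≫ (α_ V X _).hom ≫ V ◁ (ihom.ev X).app Y ≫ α.inv.app Y)

lemma uncurry_comp_tensorLeftIhomMap (α : F ≅ tensorLeft V) {W X Y : C}
    (f : W ⟶ (ihom X).obj Y) :
    uncurry (f ≫ tensorLeftIhomMap α X Y) =
      α.hom.app X ▷ W ≫ (α_ V X W).hom ≫ V ◁ uncurry f ≫ α.inv.app Y := by
  rw [uncurry_natural_left, tensorLeftIhomMap, uncurry_curry, whisker_exchange_assoc, uncurry_eq]
  simp

lemma curry'_comp_tensorLeftIhomMap (α : F ≅ tensorLeft V) {X Y : C} (f : X ⟶ Y) :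
    curry' f ≫ tensorLeftIhomMap α X Y = curry' (F.map f) := by
  apply uncurry_injective
  rw [uncurry_comp_tensorLeftIhomMap, curry', curry', uncurry_curry, uncurry_curry]
  have h : V ◁ f ≫ α.inv.app Y = α.inv.app X ≫ F.map f := α.inv.naturality f
  have h' : (α_ V X (𝟙_ C)).hom ≫ V ◁ (ρ_ X).hom = (ρ_ (V ⊗ X)).hom := by simp
  rw [MonoidalCategory.whiskerLeft_comp, Category.assoc, reassoc_of% h', h]
  refine (rightUnitor_naturality_assoc (α.hom.app X) _).trans ?_
  rw [Iso.hom_inv_id_app_assoc]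

lemma id_comp_tensorLeftIhomMap (α : F ≅ tensorLeft V) (X : C) :
    MonoidalClosed.id X ≫ tensorLeftIhomMap α X X = MonoidalClosed.id (F.obj X) := by
  rw [← curry'_id, curry'_comp_tensorLeftIhomMap, F.map_id, curry'_id]

lemma comp_comp_tensorLeftIhomMap (α : F ≅ tensorLeft V) (X Y Z : C) :
    MonoidalClosed.comp X Y Z ≫ tensorLeftIhomMap α X Z =
      (tensorLeftIhomMap α X Y ⊗ₘ tensorLeftIhomMap α Y Z) ≫
        MonoidalClosed.comp (F.obj X) (F.obj Y) (F.obj Z) := by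
  apply uncurry_injective
  rw [uncurry_comp_tensorLeftIhomMap, uncurry_natural_left, comp_eq, comp_eq, uncurry_curry,
    uncurry_curry, compTranspose_eq, compTranspose_eq, MonoidalCategory.tensorHom_def,
    MonoidalCategory.whiskerLeft_comp (F.obj X), Category.assoc]
  have key : ∀ {A B : C}, F.obj A ◁ tensorLeftIhomMap α A B ≫ (ihom.ev (F.obj A)).app (F.obj B) =
      α.hom.app A ▷ _ ≫ (α_ V A _).hom ≫ V ◁ (ihom.ev A).app B ≫ α.inv.app B := fun {A B} => by
    rw [← uncurry_eq, tensorLeftIhomMap, uncurry_curry]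
  rw [associator_inv_naturality_right_assoc, whisker_exchange_assoc]
  dsimp only [Functor.id_obj]
  rw [key, associator_inv_naturality_middle_assoc, ← comp_whiskerRight_assoc, key]
  simp only [comp_whiskerRight, Category.assoc]
  rw [← comp_whiskerRight_assoc (α.inv.app Y)]
  simp only [Functor.comp_obj, Iso.inv_hom_id_app, curriedTensor_obj_obj]
  simp

end MonoidalClosed
end CategoryTheory

/-! ### Presentations of Banach spaces by `l¹` -/

namespace Ban

variable {k : Type u} [NontriviallyNormedField k] {c : BanachConvention k}

/-- By the open mapping theorem, a surjective bounded linear map is the cokernel of any map onto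
its kernel. The zero map is written out, `Ban c` carrying no instance of zero morphisms. -/
lemma isColimit_cofork_of_exact {A B V : Ban c} {f : A ⟶ B} {π : B ⟶ V}
    (hπ : Function.Surjective (Hom.clm π))
    (hf : ∀ x, Hom.clm π x = 0 ↔ x ∈ Set.range (Hom.clm f))
    (w : f ≫ π = ofClm 0 ≫ π) : Nonempty (IsColimit (Cofork.ofπ π w)) := by
  refine ⟨Cofork.IsColimit.ofExistsUnique fun s => ?_⟩
  have hs : ∀ y, Hom.clm s.π (Hom.clm f y) = 0 := fun y =>
    (congrArg (fun e => Hom.clm e y) s.condition).trans (map_zero (Hom.clm s.π))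
  have h : ∀ x y, Hom.clm π x = Hom.clm π y → Hom.clm s.π x = Hom.clm s.π y := by
    intro x y e
    obtain ⟨z, hz⟩ := (hf (x - y)).1 (by rw [map_sub, e, sub_self])
    rw [← sub_eq_zero, ← map_sub, ← hz, hs]
  have hr := Function.surjInv_eq hπ
  let d : V →L[k] s.pt :=
    { toFun := fun v => Hom.clm s.π (Function.surjInv hπ v)
      map_add' := fun v v' => by
        rw [← map_add]
        exact h _ _ (by rw [map_add, hr, hr, hr])
      map_smul' := fun a v => by
        rw [RingHom.id_apply, ← map_smul]
        exact h _ _ (by rw [map_smul, hr, hr])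
      cont := by
        refine ((Hom.clm π).isQuotientMap hπ).continuous_iff.2 ?_
        exact (Hom.clm s.π).continuous.congr fun x => h _ _ (hr _).symm }
  refine ⟨ofClm d, hom_ext fun x => h _ _ (hr _), fun m hm => hom_ext fun v => ?_⟩
  obtain ⟨x, rfl⟩ := hπ v
  exact (congrArg (fun e => Hom.clm e x) hm).trans (h _ _ (hr _).symm)

/-- The kernel of a bounded linear map. -/
def ker {V W : Ban c} (f : V ⟶ W) : Ban c where
  carrier := LinearMap.ker (Hom.clm f).toLinearMap
  completeSpace := (Hom.clm f).isClosed_ker.completeSpace_coe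
  admits := (c.admits_iff _).2 fun x y => V.norm_add x.1 y.1

/-- The inclusion of the kernel. -/
def kerι {V W : Ban c} (f : V ⟶ W) : ker f ⟶ V :=
  ofClm (V := ker f) (LinearMap.ker (Hom.clm f).toLinearMap).subtypeL

lemma clm_eq_zero_iff_mem_range_kerι {V W : Ban c} (f : V ⟶ W) (x : V) :
    Hom.clm f x = 0 ↔ x ∈ Set.range (Hom.clm (kerι f)) :=
  ⟨fun h => ⟨⟨x, h⟩, rfl⟩, by rintro ⟨y, rfl⟩; exact y.2⟩

variable [CompleteSpace k]

/-- Every Banach space is a quotient of `l¹(S)`, with `S` its closed unit ball. -/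
lemma exists_l1_surjective (V : Ban c) :
    ∃ (S : Type u) (π : l1 S c ⟶ V), Function.Surjective (Hom.clm π) := by
  classical
  let g (s : {v : V // ‖v‖ ≤ 1}) : unit c →L[k] V := ContinuousLinearMap.toSpanSingleton k s.1
  have hg : ∀ s, ‖g s‖ ≤ 1 := fun s =>
    (ContinuousLinearMap.norm_toSpanSingleton (𝕜 := k) s.1).trans_le s.2
  refine ⟨{v : V // ‖v‖ ≤ 1}, ofClm (coprodDesc (V := fun _ => unit c) g 1 hg), fun v => ?_⟩
  -- A scalar of large norm, available as the valuation is non-trivial, scales `v` into the ball.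
  obtain ⟨a, ha⟩ := NormedField.exists_lt_norm k ‖v‖
  have ha0 : 0 < ‖a‖ := (norm_nonneg v).trans_lt ha
  have hs : ‖a⁻¹ • v‖ ≤ 1 := by
    rw [norm_smul, norm_inv, inv_mul_le_iff₀ ha0, mul_one]
    exact ha.le
  refine ⟨coprodSingle (fun _ => unit c) ⟨a⁻¹ • v, hs⟩ (a : k), ?_⟩
  refine (coprodDesc_single (V := fun _ => unit c) g 1 hg _ _).trans ?_
  exact smul_inv_smul₀ (norm_pos_iff.1 ha0) v

/-- Every Banach space is the cokernel of a map between spaces of the form `l¹(S)`. -/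
lemma exists_l1_presentation (V : Ban c) :
    ∃ (S T : Type u) (f : l1 T c ⟶ l1 S c) (π : l1 S c ⟶ V) (w : f ≫ π = ofClm 0 ≫ π),
      Nonempty (IsColimit (Cofork.ofπ π w)) := by
  obtain ⟨S, π, hπ⟩ := exists_l1_surjective V
  obtain ⟨T, q, hq⟩ := exists_l1_surjective (ker π)
  have hf : ∀ x, Hom.clm π x = 0 ↔ x ∈ Set.range (Hom.clm (q ≫ kerι π)) := by
    intro x
    rw [clm_eq_zero_iff_mem_range_kerι, clm_comp, ContinuousLinearMap.coe_comp, hq.range_comp]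
  have w : (q ≫ kerι π) ≫ π = ofClm 0 ≫ π := hom_ext fun y =>
    ((hf _).2 ⟨y, rfl⟩).trans (map_zero (Hom.clm π)).symm
  exact ⟨S, T, q ≫ kerι π, π, w, isColimit_cofork_of_exact hπ hf w⟩

open Classical in
lemma clm_coprodToTensor_single (S : Type u) (V : Ban c) (s : S) (x : V) :
    Hom.clm ((coprodToTensor S).app V) (coprodSingle (fun _ : S => V) s x) =
      tmul V (l1 S c) x (l1Basis s) := by
  exact coprodDesc_single (V := fun _ : S => V) (W := tensor V (l1 S c)) _ _ _ s x

open Classical in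
/-- The inverse `V ⊗ l¹(S) ⟶ ∐_S V`, `x ⊗ (a s)_s ↦ (a s • x)_s`, of `coprodToTensor`. -/
def tensorToCoprod (S : Type u) (V : Ban c) : V ⊗ l1 S c ⟶ (coprodFunctor S).obj V :=
  uncurry (ofClm (V := l1 S c) (W := hom V ((coprodFunctor S).obj V))
    (coprodDesc (V := fun _ : S => unit c) (W := hom V ((coprodFunctor S).obj V))
      (fun s => ContinuousLinearMap.toSpanSingleton k
        (show hom V ((coprodFunctor S).obj V) from coprodSingle (fun _ : S => V) s)) 1 fun s =>
      (ContinuousLinearMap.norm_toSpanSingleton _).trans_le <|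
        ContinuousLinearMap.opNorm_le_bound _ zero_le_one fun x => by
          rw [one_mul]
          exact norm_coprodSingle_le (fun _ : S => V) s x))

open Classical in
lemma clm_tensorToCoprod_tmul_single (S : Type u) (V : Ban c) (x : V) (s : S) (a : unit c) :
    Hom.clm (tensorToCoprod S V) (tmul V (l1 S c) x (coprodSingle (fun _ : S => unit c) s a)) =
      scalar a • coprodSingle (fun _ : S => V) s x := by
  refine (uncurry_tmul _ x _).trans ?_
  exact congrArg (fun e : V →L[k] (coprodFunctor S).obj V => e x)
    (coprodDesc_single (V := fun _ : S => unit c) (W := hom V ((coprodFunctor S).obj V)) _ _ _ s a)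

open Classical in
instance (S : Type u) (V : Ban c) : IsIso ((coprodToTensor (c := c) S).app V) := by
  refine ⟨tensorToCoprod S V, coprod_ext (S := S) fun s x => ?_, tensor_hom_ext fun x y => ?_⟩
  · refine (congrArg (Hom.clm (tensorToCoprod S V)) (clm_coprodToTensor_single S V s x)).trans ?_
    exact (clm_tensorToCoprod_tmul_single S V x s one).trans (one_smul' _)
  · have h : (Hom.clm (tensorToCoprod S V ≫ (coprodToTensor S).app V)).comp (tmul V (l1 S c) x) =
        tmul V (l1 S c) x := by
      refine coprod_ext (S := S) fun s a => ?_
      refine (congrArg (Hom.clm ((coprodToTensor S).app V))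
        (clm_tensorToCoprod_tmul_single S V x s a)).trans ?_
      refine (map_smul (Hom.clm ((coprodToTensor S).app V)) _ _).trans ?_
      rw [clm_coprodToTensor_single]
      refine (map_smul (tmul V (l1 S c) x) (scalar a) (l1Basis s)).symm.trans (congrArg _ ?_)
      refine (map_smul (coprodSingle (fun _ : S => unit c) s) (scalar a) one).symm.trans ?_
      rw [← unit_eq_smul_one]
    exact congrArg (fun e : l1 S c →L[k] tensor V (l1 S c) => e y) h

instance (S : Type u) : IsIso (coprodToTensor (c := c) S) := NatIso.isIso_of_isIso_app _

end Ban

/-! ### Constant diagrams in the ind-completion -/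

namespace IndObj

variable {C : Type (u + 1)} [Category.{u} C]

/-- The embedding of `C` into its ind-completion, by constant diagrams. -/
def constFunctor : C ⥤ IndObj C where
  obj := const
  map {A B} f := level (X := const A) (Y := const B) (𝟭 (Discrete PUnit)) 
    { app := fun _ => f
      naturality := fun _ _ _ => (Category.id_comp f).trans (Category.comp_id f).symm }
  map_id _ := hom_ext fun _ => rfl
  map_comp _ _ := hom_ext fun _ => rfl

/-- The morphism from a constant diagram attached to a class of morphisms. -/
def ofGerm {A : C} {Y : IndObj C} (g : Germ A Y) : constFunctor.obj A ⟶ Y where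
  germ _ := g
  compat {_ _} _ := g.precomp_id

lemma Germ.precomp_injective {A B : C} {Y : IndObj C} (e : B ⟶ A) [Epi e] :
    Function.Injective (Germ.precomp e : Germ A Y → Germ B Y) := by
  intro g g' h
  obtain ⟨j, f, f', rfl, rfl⟩ := g.exists_rep₂ g'
  obtain ⟨l, u, v, h⟩ := Germ.mk_eq_mk.1 h
  refine Germ.mk_eq_mk.2 ⟨l, u, v, (cancel_epi e).1 ?_⟩
  simpa only [Category.assoc] using h

/-- Filtered colimits of sets commute with equalizers: a class of morphisms that coequalizes `f`
and `g` factors through their coequalizer. -/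
lemma Germ.exists_precomp_eq {A B P : C} {Y : IndObj C} {f g : A ⟶ B} {π : B ⟶ P}
    {w : f ≫ π = g ≫ π} (h : IsColimit (Cofork.ofπ π w)) (b : Germ B Y)
    (hb : b.precomp f = b.precomp g) : ∃ d : Germ P Y, d.precomp π = b := by
  obtain ⟨j, b, rfl⟩ := b.exists_rep
  obtain ⟨l, u, v, e⟩ := Germ.mk_eq_mk.1 hb
  -- The two arrows `u, v : j ⟶ l` may differ, but are equalized further along the diagram.
  let t := u ≫ IsFiltered.coeqHom u v
  have e' : f ≫ b ≫ Y.F.map t = g ≫ b ≫ Y.F.map t := by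
    conv_rhs => rw [show t = v ≫ IsFiltered.coeqHom u v from IsFiltered.coeq_condition u v]
    simp only [Category.assoc] at e
    simp only [t, Functor.map_comp, reassoc_of% e]
  obtain ⟨d, hd⟩ := Cofork.IsColimit.desc' h (b ≫ Y.F.map t) e'
  exact ⟨.mk _ d, (congrArg (Germ.mk _) hd).trans (Germ.mk_map b t)⟩

/-- The embedding by constant diagrams preserves coequalizers. -/
lemma isColimit_cofork_const {A B P : C} {f g : A ⟶ B} {π : B ⟶ P} (w : f ≫ π = g ≫ π)
    (h : IsColimit (Cofork.ofπ π w)) :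
    Nonempty (IsColimit (Cofork.ofπ (f := constFunctor.map f) (g := constFunctor.map g)
      (constFunctor.map π) (by rw [← Functor.map_comp, w, Functor.map_comp]))) := by
  refine ⟨Cofork.IsColimit.ofExistsUnique fun s => ?_⟩
  have : Epi π := ⟨fun a b hab => Cofork.IsColimit.hom_ext h hab⟩
  obtain ⟨d, hd⟩ := Germ.exists_precomp_eq h (Hom.germ s.π (Discrete.mk PUnit.unit))
    (congrArg (fun a => Hom.germ a (Discrete.mk PUnit.unit)) s.condition)
  refine ⟨ofGerm d, congrArg ofGerm hd, fun m hm => ?_⟩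
  change ofGerm (Hom.germ m (Discrete.mk PUnit.unit)) = ofGerm d
  refine congrArg ofGerm (Germ.precomp_injective π (Eq.trans ?_ hd.symm))
  exact congrArg (fun a => Hom.germ a (Discrete.mk PUnit.unit)) hm

/-- The tautological cocone exhibiting `"colim" X i` as the colimit of the constant diagrams at
the `X i`. -/
def constCocone (X : IndObj C) : Cocone (X.F ⋙ constFunctor) where
  pt := X
  ι :=
    { app := fun i => ofGerm (.mk i (𝟙 _))
      naturality := fun i i' u => by
        have h : (Germ.mk i' (𝟙 (X.F.obj i'))).precomp (X.F.map u) = Germ.mk i (𝟙 (X.F.obj i)) :=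
          Germ.mk_eq_mk.2 ⟨i', 𝟙 i', u, by simp⟩
        exact (congrArg ofGerm h).trans (Category.comp_id _).symm }

/-- `"colim" X i` is the colimit of the constant diagrams at the `X i`. -/
def isColimitConstCocone (X : IndObj C) : IsColimit (constCocone X) where
  desc s :=
    { germ := fun i => Hom.germ (s.ι.app i) (Discrete.mk PUnit.unit)
      compat := fun u => congrArg (fun a => Hom.germ a (Discrete.mk PUnit.unit)) (s.w u) }
  fac _ _ := hom_ext fun _ => Germ.precomp_id _
  uniq _ _ hm := hom_ext fun i =>
    (Germ.precomp_id _).symm.trans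
      (congrArg (fun a => Hom.germ a (Discrete.mk PUnit.unit)) (hm i))

end IndObj

/-! ### Enrichments and the comparison with `F(k) ⊗ -` -/

namespace IndBan

open MonoidalClosed

variable {k : Type u} [NontriviallyNormedField k] [CompleteSpace k] {c : BanachConvention k}
  {F : IndBan c ⥤ IndBan c}

namespace Enrichment

/-- The enrichment of a functor isomorphic to `V ⊗ -`. -/
def ofIsoTensorLeft {V : IndBan c} (α : F ≅ tensorLeft V) : Enrichment F where
  map := tensorLeftIhomMap α
  map_id := id_comp_tensorLeftIhomMap α
  map_comp := comp_comp_tensorLeftIhomMap α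
  map_homEquiv := curry'_comp_tensorLeftIhomMap α

variable (E : Enrichment F)

/-- An enrichment is natural in the target: postcomposition with `f` is enriched composition with
the morphism from the unit that `f` corresponds to. -/
lemma ihom_map_comp_map (X : IndBan c) {Y Z : IndBan c} (f : Y ⟶ Z) :
    (ihom X).map f ≫ E.map X Z = E.map X Y ≫ (ihom (F.obj X)).map (F.map f) := by
  rw [← enrichedOrdinaryCategorySelf_eHomWhiskerLeft,
    ← enrichedOrdinaryCategorySelf_eHomWhiskerLeft]
  dsimp only [eHomWhiskerLeft]
  rw [Category.assoc, Category.assoc, E.map_comp,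
    MonoidalCategory.tensorHom_def', Category.assoc, ← MonoidalCategory.whiskerLeft_comp_assoc,
    E.map_homEquiv, whisker_exchange_assoc, rightUnitor_inv_naturality_assoc]

/-- The natural transformation `F(k) ⊗ X ⟶ F(X)` given by the enrichment: the transpose of
`X ≅ Hom(k, X) ⟶ Hom(F(k), F(X))`. -/
def tensorLeftHom : tensorLeft (F.obj (𝟙_ (IndBan c))) ⟶ F where
  app X := uncurry (curry (λ_ X).hom ≫ E.map (𝟙_ (IndBan c)) X)
  naturality X Y f := by
    rw [curriedTensor_obj_map, ← uncurry_natural_left, ← uncurry_natural_right, Category.assoc,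
      ← ihom_map_comp_map, ← curry_natural_left_assoc, leftUnitor_naturality,
      curry_natural_right_assoc]

lemma tensorLeftHom_app_ofIsoTensorLeft {V : IndBan c} (α : F ≅ tensorLeft V) (X : IndBan c) :
    (ofIsoTensorLeft α).tensorLeftHom.app X = α.hom.app (𝟙_ (IndBan c)) ▷ X ≫
      (α_ V (𝟙_ (IndBan c)) X).hom ≫ V ◁ (λ_ X).hom ≫ α.inv.app X :=
  (uncurry_comp_tensorLeftIhomMap α _).trans (by rw [uncurry_curry])

lemma isIso_tensorLeftHom_app_ofIsoTensorLeft {V : IndBan c} (α : F ≅ tensorLeft V)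
    (X : IndBan c) : IsIso ((ofIsoTensorLeft α).tensorLeftHom.app X) := by
  rw [tensorLeftHom_app_ofIsoTensorLeft]
  infer_instance

lemma l1Comparison_eq (S : Type u) : E.l1Comparison S =
    coprodToTensor S (F.obj (𝟙_ (IndBan c))) ≫ E.tensorLeftHom.app (l1 S c) := rfl

end Enrichment
end IndBan

/-! ### Reduction to the spaces `l¹(S)` -/

namespace IndBan

open IndObj

variable {k : Type u} [NontriviallyNormedField k] [CompleteSpace k] {c : BanachConvention k}

/-- The ind-Banach space `l¹(S)` is the constant diagram at the Banach space `l¹(S)`. -/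
def constL1Iso (S : Type u) : constFunctor.obj (Ban.l1 S c) ≅ l1 S c where
  hom := ofGerm (.mk (Y := l1 S c) (Discrete.mk PUnit.unit) (𝟙 (Ban.l1 S c)))
  inv := level (X := l1 S c) (Y := const (Ban.l1 S c)) (𝟭 (Discrete PUnit))
    { app := fun _ => 𝟙 (Ban.l1 S c)
      naturality := fun _ _ _ => congrArg (fun e => e ≫ 𝟙 (Ban.l1 S c))
        ((Ban.coprodFunctor S).map_id (Ban.unit c)) }
  hom_inv_id := hom_ext fun _ => congrArg (Germ.mk _) (Category.comp_id (𝟙 (Ban.l1 S c)))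
  inv_hom_id := hom_ext fun _ => congrArg (Germ.mk (Y := l1 S c) _)
    (Category.comp_id (𝟙 (Ban.l1 S c)))

/-- The isomorphism `∐_S V ≅ V ⊗ l¹(S)` of Banach spaces, applied to each constituent. -/
instance (S : Type u) (X : IndBan c) : IsIso (coprodToTensor S X) := by
  have h : ∀ {i i' : X.I} (u : i ⟶ i'),
      (X.F.map u ⊗ₘ (Ban.coprodFunctor S).map (𝟙 (Ban.unit c))) ≫
        (inv (Ban.coprodToTensor S)).app (X.F.obj i') =
      (inv (Ban.coprodToTensor S)).app (X.F.obj i) ≫ (Ban.coprodFunctor S).map (X.F.map u) := by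
    intro i i' u
    rw [CategoryTheory.Functor.map_id]
    exact (congrArg (fun e => e ≫ _) (tensorHom_id _ _)).trans
      ((inv (Ban.coprodToTensor S)).naturality (X.F.map u))
  refine ⟨level (X := X ⊗ l1 S c) (Y := (contractingCoprod S).obj X)
    (CategoryTheory.Prod.fst X.I (Discrete PUnit))
    { app := fun p => (inv (Ban.coprodToTensor S)).app (X.F.obj p.1)
      naturality := fun _ _ u => h u.1 }, hom_ext fun i => ?_, hom_ext fun p => ?_⟩
  · exact congrArg (Germ.mk (Y := (contractingCoprod S).obj X) i)
      (NatTrans.congr_app (IsIso.hom_inv_id (Ban.coprodToTensor S)) (X.F.obj i))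
  · exact congrArg (Germ.mk (Y := X ⊗ l1 S c) p)
      (NatTrans.congr_app (IsIso.inv_hom_id (Ban.coprodToTensor S)) (X.F.obj p.1))

/-- A natural transformation between cocontinuous functors on ind-Banach spaces is invertible as
soon as it is so on the spaces `l¹(S)`, since these generate under colimits. -/
lemma isIso_of_isIso_app_l1 {F G : IndBan c ⥤ IndBan c} [PreservesColimitsOfSize.{u, u} F]
    [PreservesColimitsOfSize.{u, u} G] (τ : F ⟶ G) (h : ∀ S : Type u, IsIso (τ.app (l1 S c))) :
    IsIso τ := by
  have h₁ : ∀ S : Type u, IsIso (τ.app (constFunctor.obj (Ban.l1 S c))) := fun S =>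
    (NatTrans.isIso_app_iff_of_iso τ (constL1Iso S)).2 (h S)
  have h₂ : ∀ V : Ban c, IsIso (τ.app (constFunctor.obj V)) := fun V => by
    obtain ⟨S, T, f, π, w, ⟨hc⟩⟩ := Ban.exists_l1_presentation V
    obtain ⟨hc'⟩ := isColimit_cofork_const w hc
    -- The shape of a parallel pair lives in the lowest universe, hence the detour through finite
    -- colimits.
    have := PreservesColimitsOfSize.preservesFiniteColimits F
    have := PreservesColimitsOfSize.preservesFiniteColimits G
    have : IsIso (Functor.whiskerLeft
        (parallelPair (constFunctor.map f) (constFunctor.map (Ban.ofClm 0))) τ) := by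
      refine (NatTrans.isIso_iff_isIso_app _).2 ?_
      rintro (_ | _)
      exacts [h₁ T, h₁ S]
    exact isIso_app_coconePt_of_preservesColimit _ τ _ hc'
  refine (NatTrans.isIso_iff_isIso_app τ).2 fun X => ?_
  have : IsIso (Functor.whiskerLeft (X.F ⋙ constFunctor) τ) :=
    (NatTrans.isIso_iff_isIso_app _).2 fun i => h₂ (X.F.obj i)
  exact isIso_app_coconePt_of_preservesColimit _ τ _ (isColimitConstCocone X)

end IndBan

end

theorem lemma3p5 {k : Type u} [NontriviallyNormedField k] [CompleteSpace k]
    (c : BanachConvention k) (𝒱 : IndBan c ⥤ IndBan c) :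
    ((∃ V : IndBan c, Nonempty (𝒱 ≅ tensorLeft V)) ↔
      ∃ E : IndBan.Enrichment 𝒱,
        PreservesColimitsOfSize.{u, u} 𝒱 ∧ E.CommutesWithL1) ∧
    ∀ V : IndBan c, Nonempty (𝒱 ≅ tensorLeft V) → Nonempty (V ≅ 𝒱.obj (𝟙_ (IndBan c))) := by
  refine ⟨⟨?_, ?_⟩, fun V ⟨α⟩ => ⟨(ρ_ V).symm ≪≫ (α.app (𝟙_ (IndBan c))).symm⟩⟩
  · rintro ⟨V, ⟨α⟩⟩
    refine ⟨.ofIsoTensorLeft α, preservesColimits_of_natIso α.symm, fun S => ?_⟩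
    have := IndBan.Enrichment.isIso_tensorLeftHom_app_ofIsoTensorLeft α (IndBan.l1 S c)
    rw [IndBan.Enrichment.l1Comparison_eq]
    infer_instance
  · rintro ⟨E, _, hE⟩
    have : IsIso E.tensorLeftHom := IndBan.isIso_of_isIso_app_l1 _ fun S => by
      have := hE S
      rw [E.l1Comparison_eq] at this
      exact IsIso.of_isIso_comp_left (IndBan.coprodToTensor S _) _
    exact ⟨_, ⟨(asIso E.tensorLeftHom).symm⟩⟩
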